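/- Let $n,q\ge 0$ be integers. A dyadic resolution of unity for $\mathbb{R}^n$ is a sequence $(\phi_j)_{j\ge0}$ of real-valued Schwartz functions on $\mathbb{R}^n$ such that the Fourier transform $\hat\phi_0(\xi)=\int\phi_0(x)e^{-2\pi i x\cdot\xi}\,dx$ satisfies $\operatorname{supp}\hat\phi_0\subset\{|\xi|<2\}$ and $\hat\phi_0=1$ on $\{|\xi|<1\}$, and $\phi_j(x)=2^{nj}\phi_0(2^jx)-2^{n(j-1)}\phi_0(2^{j-1}x)$ for $j\ge1$. Fix dyadic resolutions $\phi=(\phi_j)_{j\ge0}$ for $\mathbb{R}^n$ and $\psi=(\psi_k)_{k\ge0}$ for $\mathbb{R}^q$. For a tempered distribution $f$ on $\mathbb{R}^n_x\times\mathbb{R}^q_s$ let $\phi_j\ast_xf=(\phi_j\otimes\delta_0)\ast f$ and $\psi_k\ast_sf=(\delta_0\otimes\psi_k)\ast f$ be the partial convolutions, and for $a,b,c\in\mathbb{R}$ put $$\|f\|_{\mathscr{C}^aL^\infty}=\sup_{j\ge0}2^{ja}\|\phi_j\ast_xf\|_{L^\infty(\mathbb{R}^n\times\mathbb{R}^q)},\qquad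 \|f\|_{\mathscr{C}^c\mathscr{C}^b}=\sup_{j,k\ge0}2^{jc+kb}\|\phi_j\ast_x(\psi_k\ast_sf)\|_{L^\infty(\mathbb{R}^n\times\mathbb{R}^q)},$$ $$\|f\|_{\mathscr{C}^aL^\infty\cap\mathscr{C}^c\mathscr{C}^b}=\|f\|_{\mathscr{C}^aL^\infty}+\|f\|_{\mathscr{C}^c\mathscr{C}^b},$$ where the $L^\infty$-norm of a distribution that is not given by an $L^\infty$ function is $\infty$. Let $\mathscr{C}^aL^\infty\cap\mathscr{C}^c\mathscr{C}^b$ be the space of all (real- or complex-valued) tempered distributions on $\mathbb{R}^n\times\mathbb{R}^q$ for which the last norm is finite. Let $\alpha,\beta>0$ and $\eta,\theta\in[0,1]$ satisfy $\eta+\theta<\alpha$. Then there is a constant $C>0$, depending only on $n,q,\alpha,\beta,\eta,\theta,\phi,\psi$, such that for all $f\in\mathscr{C}^{\alpha}L^\infty\cap\mathscr{C}^{-\eta}\mathscr{C}^\beta$ and $g\in\mathscr{C}^{\alpha-\theta}L^\infty\cap\mathscr{C}^{-\eta-\theta}\mathscr{C}^\beta$: the distributions $f$ and $g$ are given by $L^\infty$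 functions, so that their pointwise product $fg\in L^\infty(\mathbb{R}^n\times\mathbb{R}^q)$ is well defined; $fg\in\mathscr{C}^{\alpha-\theta}L^\infty\cap\mathscr{C}^{-\eta-\theta}\mathscr{C}^\beta$; and $$\|fg\|_{\mathscr{C}^{\alpha-\theta}L^\infty\cap\mathscr{C}^{-\eta-\theta}\mathscr{C}^\beta}\le C\,\|f\|_{\mathscr{C}^{\alpha}L^\infty\cap\mathscr{C}^{-\eta}\mathscr{C}^\beta}\,\|g\|_{\mathscr{C}^{\alpha-\theta}L^\infty\cap\mathscr{C}^{-\eta-\theta}\mathscr{C}^\beta}.$$ -/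

import Mathlib

open scoped SchwartzMap ENNReal FourierTransform
open MeasureTheory

noncomputable section

namespace BiHolder

/-- The weighted translates `x ↦ ∫ ρ(z) h(x + L z) dz` of a function `h` along a linear map `L`. -/
def avgFun {E G V : Type} [NormedAddCommGroup E] [NormedSpace ℝ E] [MeasureSpace E]
    [NormedAddCommGroup G] [NormedSpace ℝ G]
    [NormedAddCommGroup V] [NormedSpace ℝ V] [NormedSpace ℂ V]
    (L : E →L[ℝ] G) (ρ : 𝓢(E, ℂ)) (h : G → V) (x : G) : V :=
  ∫ z, ρ z • h (x + L z)

theorem integrable_avg {E G V : Type} [NormedAddCommGroup E] [NormedSpace ℝ E]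
    [FiniteDimensional ℝ E] [MeasureSpace E] [BorelSpace E]
    [(volume : Measure E).IsAddHaarMeasure]
    [NormedAddCommGroup G] [NormedSpace ℝ G]
    [NormedAddCommGroup V] [NormedSpace ℝ V] [NormedSpace ℂ V] [SMulCommClass ℝ ℂ V]
    (L : E →L[ℝ] G) (ρ : 𝓢(E, ℂ)) (h : 𝓢(G, V)) (x : G) :
    Integrable (fun z => ρ z • h (x + L z)) := by
  refine (ρ.integrable.norm.mul_const (SchwartzMap.seminorm ℝ 0 0 h)).mono' ?_ ?_
  · have : Continuous (fun z => ρ z • h (x + L z)) :=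
      ρ.continuous.smul (h.continuous.comp (by fun_prop))
    exact this.aestronglyMeasurable
  · refine Filter.Eventually.of_forall fun z => ?_
    rw [norm_smul]
    gcongr
    exact SchwartzMap.norm_le_seminorm ℝ h _

theorem hasFDerivAt_avgFun {E G V : Type} [NormedAddCommGroup E] [NormedSpace ℝ E]
    [FiniteDimensional ℝ E] [MeasureSpace E] [BorelSpace E]
    [(volume : Measure E).IsAddHaarMeasure]
    [NormedAddCommGroup G] [NormedSpace ℝ G]
    [NormedAddCommGroup V] [NormedSpace ℝ V] [NormedSpace ℂ V] [SMulCommClass ℝ ℂ V]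
    (L : E →L[ℝ] G) (ρ : 𝓢(E, ℂ)) (h : 𝓢(G, V)) (x : G) :
    HasFDerivAt (avgFun L ρ h) (avgFun L ρ (SchwartzMap.fderivCLM ℝ G V h) x) x := by
  refine hasFDerivAt_integral_of_dominated_of_fderiv_le (s := Set.univ)
    (F' := fun x z => ρ z • SchwartzMap.fderivCLM ℝ G V h (x + L z))
    (bound := fun z => ‖ρ z‖ * SchwartzMap.seminorm ℝ 0 0 (SchwartzMap.fderivCLM ℝ G V h))
    Filter.univ_mem (Filter.Eventually.of_forall fun y => ?_) (integrable_avg L ρ h x)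
    (integrable_avg L ρ (SchwartzMap.fderivCLM ℝ G V h) x).aestronglyMeasurable
    (Filter.Eventually.of_forall fun z y _ => ?_) (ρ.integrable.norm.mul_const _)
    (Filter.Eventually.of_forall fun z y _ => ?_)
  · exact (integrable_avg L ρ h y).aestronglyMeasurable
  · rw [norm_smul]
    gcongr
    exact SchwartzMap.norm_le_seminorm ℝ (SchwartzMap.fderivCLM ℝ G V h) _
  · have h1 : HasFDerivAt h (SchwartzMap.fderivCLM ℝ G V h (y + L z)) (y + L z) := by
      rw [SchwartzMap.fderivCLM_apply]
      exact h.differentiableAt.hasFDerivAt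
    have h2 : HasFDerivAt (fun y => h (y + L z)) (SchwartzMap.fderivCLM ℝ G V h (y + L z)) y :=
      h1.comp y ((hasFDerivAt_id y).add_const (L z))
    exact h2.const_smul (ρ z)

theorem contDiff_avgFun {E G : Type} [NormedAddCommGroup E] [NormedSpace ℝ E]
    [FiniteDimensional ℝ E] [MeasureSpace E] [BorelSpace E]
    [(volume : Measure E).IsAddHaarMeasure]
    [NormedAddCommGroup G] [NormedSpace ℝ G] (L : E →L[ℝ] G) (ρ : 𝓢(E, ℂ)) (n : ℕ) :
    ∀ {V : Type} [NormedAddCommGroup V] [NormedSpace ℝ V] [NormedSpace ℂ V] [SMulCommClass ℝ ℂ V]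
      (h : 𝓢(G, V)), ContDiff ℝ n (avgFun L ρ h) := by
  induction n with
  | zero =>
    intro V _ _ _ _ h
    exact contDiff_zero.2
      (continuous_iff_continuousAt.2 fun x => (hasFDerivAt_avgFun L ρ h x).continuousAt)
  | succ n ih =>
    intro V _ _ _ _ h
    push_cast
    exact contDiff_succ_iff_hasFDerivAt.2 ⟨_, ih (SchwartzMap.fderivCLM ℝ G V h),
      hasFDerivAt_avgFun L ρ h⟩

theorem norm_iteratedFDeriv_avgFun_le {E G : Type} [NormedAddCommGroup E] [NormedSpace ℝ E]
    [FiniteDimensional ℝ E] [MeasureSpace E] [BorelSpace E]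
    [(volume : Measure E).IsAddHaarMeasure]
    [NormedAddCommGroup G] [NormedSpace ℝ G] (L : E →L[ℝ] G) (ρ : 𝓢(E, ℂ)) (n : ℕ) :
    ∀ {V : Type} [NormedAddCommGroup V] [NormedSpace ℝ V] [NormedSpace ℂ V] [SMulCommClass ℝ ℂ V]
      (h : 𝓢(G, V)) (x : G), ‖iteratedFDeriv ℝ n (avgFun L ρ h) x‖ ≤
        ∫ z, ‖ρ z‖ * ‖iteratedFDeriv ℝ n h (x + L z)‖ := by
  induction n with
  | zero =>
    intro V _ _ _ _ h x
    simp only [norm_iteratedFDeriv_zero, ← norm_smul]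
    exact norm_integral_le_integral_norm _
  | succ n ih =>
    intro V _ _ _ _ h x
    have h1 : fderiv ℝ (avgFun L ρ h) = avgFun L ρ (SchwartzMap.fderivCLM ℝ G V h) :=
      funext fun y => (hasFDerivAt_avgFun L ρ h y).fderiv
    have h2 : (SchwartzMap.fderivCLM ℝ G V h : G → G →L[ℝ] V) = fderiv ℝ h :=
      funext fun y => SchwartzMap.fderivCLM_apply ℝ h y
    have h3 := ih (SchwartzMap.fderivCLM ℝ G V h) x
    rw [← h1, h2] at h3
    simpa only [norm_iteratedFDeriv_fderiv] using h3

theorem avgFun_decay {E G V : Type} [NormedAddCommGroup E] [NormedSpace ℝ E]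
    [FiniteDimensional ℝ E] [MeasureSpace E] [BorelSpace E]
    [(volume : Measure E).IsAddHaarMeasure]
    [NormedAddCommGroup G] [NormedSpace ℝ G]
    [NormedAddCommGroup V] [NormedSpace ℝ V] [NormedSpace ℂ V] [SMulCommClass ℝ ℂ V]
    (L : E →L[ℝ] G) (ρ : 𝓢(E, ℂ)) (k n : ℕ) :
    ∃ C : ℝ, 0 ≤ C ∧ ∀ (h : 𝓢(G, V)) (x : G),
      ‖x‖ ^ k * ‖iteratedFDeriv ℝ n (avgFun L ρ h) x‖ ≤
        C * ((Finset.Iic (k, n)).sup (schwartzSeminormFamily ℂ G V)) h := by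
  have hint : Integrable (fun z => (‖ρ z‖ + ‖z‖ ^ k * ‖ρ z‖)) :=
    ρ.integrable.norm.add (ρ.integrable_pow_mul volume k)
  refine ⟨(∫ z, (‖ρ z‖ + ‖z‖ ^ k * ‖ρ z‖)) * (2 ^ k * (1 + ‖L‖ ^ k) * 2 ^ k), ?_, ?_⟩
  · exact mul_nonneg (integral_nonneg fun z => by positivity) (by positivity)
  intro h x
  set S := ((Finset.Iic (k, n)).sup (schwartzSeminormFamily ℂ G V)) h with hS
  have hS0 : 0 ≤ S := apply_nonneg _ _
  calc ‖x‖ ^ k * ‖iteratedFDeriv ℝ n (avgFun L ρ h) x‖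
      ≤ ‖x‖ ^ k * ∫ z, ‖ρ z‖ * ‖iteratedFDeriv ℝ n h (x + L z)‖ := by
        gcongr
        exact norm_iteratedFDeriv_avgFun_le L ρ n h x
    _ = ∫ z, ‖x‖ ^ k * (‖ρ z‖ * ‖iteratedFDeriv ℝ n h (x + L z)‖) := by
        rw [integral_const_mul]
    _ ≤ ∫ z, (‖ρ z‖ + ‖z‖ ^ k * ‖ρ z‖) * (2 ^ k * (1 + ‖L‖ ^ k) * 2 ^ k * S) := by
        refine integral_mono_of_nonneg (Filter.Eventually.of_forall fun z => by positivity)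
          (hint.mul_const _) (Filter.Eventually.of_forall fun z => ?_)
        have hS1 : (1 + ‖x + L z‖) ^ k * ‖iteratedFDeriv ℝ n h (x + L z)‖ ≤ 2 ^ k * S :=
          SchwartzMap.one_add_le_sup_seminorm_apply (𝕜 := ℂ) (m := (k, n)) le_rfl le_rfl h _
        have hx : ‖x‖ ≤ (1 + ‖x + L z‖) * (1 + ‖L‖ * ‖z‖) := by
          have h1 : ‖x‖ ≤ ‖x + L z‖ + ‖L z‖ := by
            simpa using norm_sub_le (x + L z) (L z)
          have h2 := L.le_opNorm z
          nlinarith [norm_nonneg (x + L z), mul_nonneg (norm_nonneg L) (norm_nonneg z)]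
        have h4 : (1 + ‖L‖ * ‖z‖) ^ k ≤ 2 ^ k * ((1 + ‖L‖ ^ k) * (1 + ‖z‖ ^ k)) := by
          have h5 : 1 + ‖L‖ * ‖z‖ ≤ 2 * max 1 (‖L‖ * ‖z‖) := by
            linarith [le_max_left 1 (‖L‖ * ‖z‖), le_max_right 1 (‖L‖ * ‖z‖)]
          calc (1 + ‖L‖ * ‖z‖) ^ k ≤ (2 * max 1 (‖L‖ * ‖z‖)) ^ k := by gcongr
            _ = 2 ^ k * (max 1 (‖L‖ * ‖z‖)) ^ k := mul_pow _ _ _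
            _ ≤ 2 ^ k * ((1 + ‖L‖ ^ k) * (1 + ‖z‖ ^ k)) := by
              gcongr
              have hL : 0 ≤ ‖L‖ ^ k := by positivity
              have hz : 0 ≤ ‖z‖ ^ k := by positivity
              rcases le_total 1 (‖L‖ * ‖z‖) with h6 | h6
              · rw [max_eq_right h6, mul_pow]; nlinarith
              · rw [max_eq_left h6, one_pow]; nlinarith
        calc ‖x‖ ^ k * (‖ρ z‖ * ‖iteratedFDeriv ℝ n h (x + L z)‖)
            ≤ ((1 + ‖x + L z‖) * (1 + ‖L‖ * ‖z‖)) ^ k *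
                (‖ρ z‖ * ‖iteratedFDeriv ℝ n h (x + L z)‖) := by gcongr
          _ = ‖ρ z‖ * (1 + ‖L‖ * ‖z‖) ^ k *
                ((1 + ‖x + L z‖) ^ k * ‖iteratedFDeriv ℝ n h (x + L z)‖) := by
              rw [mul_pow]; ring
          _ ≤ ‖ρ z‖ * (2 ^ k * ((1 + ‖L‖ ^ k) * (1 + ‖z‖ ^ k))) * (2 ^ k * S) := by gcongr
          _ = (‖ρ z‖ + ‖z‖ ^ k * ‖ρ z‖) * (2 ^ k * (1 + ‖L‖ ^ k) * 2 ^ k * S) := by ring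
    _ = (∫ z, (‖ρ z‖ + ‖z‖ ^ k * ‖ρ z‖)) * (2 ^ k * (1 + ‖L‖ ^ k) * 2 ^ k) * S := by
        rw [integral_mul_const]; ring

/-- The continuous linear operator `h ↦ (x ↦ ∫ ρ(z) h(x + L z) dz)` on Schwartz functions. -/
def avgCLM {E G : Type} [NormedAddCommGroup E] [NormedSpace ℝ E]
    [FiniteDimensional ℝ E] [MeasureSpace E] [BorelSpace E]
    [(volume : Measure E).IsAddHaarMeasure]
    [NormedAddCommGroup G] [NormedSpace ℝ G]
    (L : E →L[ℝ] G) (ρ : 𝓢(E, ℂ)) : 𝓢(G, ℂ) →L[ℂ] 𝓢(G, ℂ) :=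
  SchwartzMap.mkCLM (fun h => avgFun L ρ h)
    (fun f g x => by
      simp only [avgFun, ← integral_add (integrable_avg L ρ f x) (integrable_avg L ρ g x)]
      congr 1; ext z; simp [mul_add])
    (fun a f x => by
      simp only [avgFun, RingHom.id_apply, ← integral_smul]
      congr 1; ext z; simp; ring)
    (fun f => contDiff_infty.2 fun n => contDiff_avgFun L ρ n f)
    (fun m => by
      obtain ⟨C, hC, hb⟩ := avgFun_decay (V := ℂ) L ρ m.1 m.2
      exact ⟨_, C, hC, hb⟩)

theorem avgCLM_apply {E G : Type} [NormedAddCommGroup E] [NormedSpace ℝ E]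
    [FiniteDimensional ℝ E] [MeasureSpace E] [BorelSpace E]
    [(volume : Measure E).IsAddHaarMeasure]
    [NormedAddCommGroup G] [NormedSpace ℝ G]
    (L : E →L[ℝ] G) (ρ : 𝓢(E, ℂ)) (h : 𝓢(G, ℂ)) (x : G) :
    avgCLM L ρ h x = ∫ z, ρ z * h (x + L z) := rfl

/-- `ℝⁿ` with its Euclidean norm. -/
abbrev Rn (n : ℕ) : Type := EuclideanSpace ℝ (Fin n)

instance instIsAddHaarMeasureProd (n q : ℕ) :
    (volume : Measure (Rn n × Rn q)).IsAddHaarMeasure :=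
  inferInstanceAs ((volume : Measure (Rn n)).prod (volume : Measure (Rn q))).IsAddHaarMeasure

/-- Tempered distributions on `ℝⁿ × ℝ^q` (variables `x ∈ ℝⁿ`, `s ∈ ℝ^q`). -/
abbrev Dist (n q : ℕ) : Type := 𝓢'(Rn n × Rn q, ℂ)

/-- The convolution `ρ ∗ₓ f = (ρ ⊗ δ₀) ∗ f` in the `x`-variable, defined by duality:
`⟨ρ ∗ₓ f, h⟩ = ⟨f, h'⟩` with `h'(x, s) = ∫ ρ(z) h(x + z, s) dz`. -/
def convX {n q : ℕ} (ρ : 𝓢(Rn n, ℂ)) (f : Dist n q) : Dist n q :=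
  PointwiseConvergenceCLM.precomp ℂ (avgCLM (ContinuousLinearMap.inl ℝ (Rn n) (Rn q)) ρ) f

/-- The convolution `ρ ∗ₛ f = (δ₀ ⊗ ρ) ∗ f` in the `s`-variable, defined by duality:
`⟨ρ ∗ₛ f, h⟩ = ⟨f, h'⟩` with `h'(x, s) = ∫ ρ(z) h(x, s + z) dz`. -/
def convS {n q : ℕ} (ρ : 𝓢(Rn q, ℂ)) (f : Dist n q) : Dist n q :=
  PointwiseConvergenceCLM.precomp ℂ (avgCLM (ContinuousLinearMap.inr ℝ (Rn n) (Rn q)) ρ) f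

/-- A Fourier dyadic resolution of unity for `ℝⁿ`: real-valued Schwartz functions `φ₀, φ₁, …`
with `supp φ̂₀ ⊆ {|ξ| < 2}`, `φ̂₀ = 1` on `{|ξ| < 1}` and
`φⱼ(x) = 2^{nj} φ₀(2ʲ x) - 2^{n(j-1)} φ₀(2^{j-1} x)` for `j ≥ 1`. -/
structure IsDyadicResolution {n : ℕ} (φ : ℕ → 𝓢(Rn n, ℂ)) : Prop where
  real : ∀ j x, (φ j x).im = 0
  tsupport_fourier : tsupport (𝓕 (φ 0) : 𝓢(Rn n, ℂ)) ⊆ Metric.ball 0 2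
  fourier_eq_one : ∀ ξ : Rn n, ‖ξ‖ < 1 → (𝓕 (φ 0) : 𝓢(Rn n, ℂ)) ξ = 1
  succ : ∀ (j : ℕ) (x : Rn n), φ (j + 1) x =
    2 ^ (n * (j + 1)) * φ 0 ((2 : ℝ) ^ (j + 1) • x) - 2 ^ (n * j) * φ 0 ((2 : ℝ) ^ j • x)

/-- The `L^∞(ℝⁿ × ℝ^q)`-norm of a tempered distribution: the norm of the (unique) `L^∞` function
which represents it, and `∞` if there is none. -/
def linftyNorm {n q : ℕ} (f : Dist n q) : ℝ≥0∞ :=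
  ⨅ (F : Lp ℂ ∞ (volume : Measure (Rn n × Rn q))) (_ : Lp.toTemperedDistribution F = f), ‖F‖ₑ

/-- The norm of `𝒞^a_x L^∞_s (ℝⁿ, ℝ^q)`: `sup_j 2^{ja} ‖φⱼ ∗ₓ f‖_{L^∞}`
(`∞` when `f` is not in the space). -/
def normCL {n q : ℕ} (φ : ℕ → 𝓢(Rn n, ℂ)) (a : ℝ) (f : Dist n q) : ℝ≥0∞ :=
  ⨆ j : ℕ, (2 : ℝ≥0∞) ^ ((j : ℝ) * a) * linftyNorm (convX (φ j) f)

/-- The norm of `𝒞^a_x 𝒞^b_s (ℝⁿ, ℝ^q)`: `sup_{j,k} 2^{ja + kb} ‖φⱼ ∗ₓ (ψₖ ∗ₛ f)‖_{L^∞}`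
(`∞` when `f` is not in the space). -/
def normCC {n q : ℕ} (φ : ℕ → 𝓢(Rn n, ℂ)) (ψ : ℕ → 𝓢(Rn q, ℂ)) (a b : ℝ)
    (f : Dist n q) : ℝ≥0∞ :=
  ⨆ (j : ℕ) (k : ℕ),
    (2 : ℝ≥0∞) ^ ((j : ℝ) * a + (k : ℝ) * b) * linftyNorm (convX (φ j) (convS (ψ k) f))

/-- The norm of `𝒞^a_x L^∞_s ∩ 𝒞^c_x 𝒞^b_s (ℝⁿ, ℝ^q)`. -/
def normInter {n q : ℕ} (φ : ℕ → 𝓢(Rn n, ℂ)) (ψ : ℕ → 𝓢(Rn q, ℂ)) (a c b : ℝ)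
    (f : Dist n q) : ℝ≥0∞ :=
  normCL φ a f + normCC φ ψ c b f

/-- The space `𝒞^a_x L^∞_s ∩ 𝒞^c_x 𝒞^b_s (ℝⁿ, ℝ^q)`. -/
def spaceInter {n q : ℕ} (φ : ℕ → 𝓢(Rn n, ℂ)) (ψ : ℕ → 𝓢(Rn q, ℂ)) (a c b : ℝ) :
    Set (Dist n q) :=
  {f | normInter φ ψ a c b f < ∞}

/-- `h` is the pointwise product of `f` and `g`: the three tempered distributions are given by
`L^∞` functions `F`, `G`, `H` with `H = F G` almost everywhere. -/
def IsPointwiseProduct {n q : ℕ} (f g h : Dist n q) : Prop :=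
  ∃ F G H : Lp ℂ ∞ (volume : Measure (Rn n × Rn q)),
    Lp.toTemperedDistribution F = f ∧ Lp.toTemperedDistribution G = g ∧
      Lp.toTemperedDistribution H = h ∧ ∀ᵐ z, H z = F z * G z

end BiHolder

end

/-! Decompose f = Σ f_i and g = Σ g_j into dyadic blocks in the variable x. With A, B the two norms
of f and A', B' those of g, the blocks satisfy ‖f_i‖ ≤ 2^{-iα} A and ‖g_j‖ ≤ 2^{-j(α-θ)} A'. Both
exponents are positive, so the two series converge absolutely in L^∞; f and g are therefore bounded
functions (`IsDyadicResolution.exists_toDist_eq`), and the product is unambiguous because L^∞ embeds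
injectively into tempered distributions.

The Fourier support of f_i g_j forces φ_a ∗ₓ (f_i g_j) = 0 unless the largest of a, i, j exceeds the
second largest by at most 2 (`Resonant`, `conv_mul_conv_eq_zero`). In s, a product of two bounded
functions of regularity β > 0 has regularity β (`IsDyadicResolution.exists_product_le`). Applied to
f_i and g_j, this bounds the b-th s-block of f_i g_j by a multiple of 2^{-bβ} (2^{iη - j(α-θ)} B A'
+ 2^{j(η+θ) - iα} A B').

It remains to sum over resonant pairs (`exists_tsum_resonant_le`). The first term sums to O(2^{aη})
because η < α - θ, the second to O(2^{a(η+θ)}) because η + θ < α: a single condition serves both.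
This is the mixed estimate `IsDyadicResolution.exists_mixed_product_le`. The 𝒞^{α-θ} L^∞ bound is
`exists_product_le` again, now in x with exponent α - θ. -/

namespace BiHolder

/-! ### Fourier supports of products of Schwartz kernels -/

section Kernel

variable {V : Type} [NormedAddCommGroup V] [InnerProductSpace ℝ V] [FiniteDimensional ℝ V]
  [MeasurableSpace V] [BorelSpace V]

theorem schwartz_eq_integral_fourier (χ : 𝓢(V, ℂ)) (y : V) :
    χ y = ∫ ξ, (𝓕 χ : 𝓢(V, ℂ)) ξ * Complex.exp (2 * Real.pi * inner ℝ ξ y * Complex.I) := by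
  conv_lhs => rw [← FourierTransform.fourierInv_fourier_eq (F := 𝓢(V, ℂ)) χ]
  rw [SchwartzMap.fourierInv_coe, Real.fourierInv_eq']
  refine integral_congr_ae (Filter.Eventually.of_forall fun ξ => ?_)
  simp only [smul_eq_mul]
  rw [mul_comm]
  push_cast
  rfl

/-- The convolution-type kernel of three Schwartz functions vanishes when their Fourier transforms
are incompatible. -/
theorem integral_mul_mul_eq_zero (ρ χ κ : 𝓢(V, ℂ))
    (h : ∀ ξ ζ : V, (𝓕 ρ : 𝓢(V, ℂ)) (ξ + ζ) * (𝓕 χ : 𝓢(V, ℂ)) ξ * (𝓕 κ : 𝓢(V, ℂ)) ζ = 0)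
    (y w : V) : ∫ z, ρ z * χ (y - z) * κ (w - z) = 0 := by
  set e : V → V → ℂ := fun ξ y => Complex.exp (2 * Real.pi * inner ℝ ξ y * Complex.I) with he
  have hen : ∀ ξ y, ‖e ξ y‖ = 1 := fun ξ y => by
    have := Complex.norm_exp_ofReal_mul_I (2 * Real.pi * inner ℝ ξ y)
    push_cast at this
    exact this
  have hadd : ∀ ξ y z, e ξ (y - z) = e ξ y * e ξ (-z) := fun ξ y z => by
    simp only [he, ← Complex.exp_add, sub_eq_add_neg, inner_add_right]
    push_cast
    congr 1
    ring
  have hadd' : ∀ ξ ζ z, e ξ z * e ζ z = e (ξ + ζ) z := fun ξ ζ z => by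
    simp only [he, ← Complex.exp_add, inner_add_left]
    push_cast
    congr 1
    ring
  have hcont : Continuous (fun p : V × V => e p.1 p.2) := by
    simp only [he]
    fun_prop
  set X : 𝓢(V, ℂ) := 𝓕 χ
  set K : 𝓢(V, ℂ) := 𝓕 κ
  have h1 : ∀ z, ρ z * χ (y - z) * κ (w - z) =
      ∫ p : V × V, ρ z * ((X p.1 * e p.1 (y - z)) * (K p.2 * e p.2 (w - z))) := fun z => by
    rw [integral_const_mul, Measure.volume_eq_prod,
      integral_prod_mul (fun ξ => X ξ * e ξ (y - z)) (fun ζ => K ζ * e ζ (w - z)),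
      schwartz_eq_integral_fourier χ, schwartz_eq_integral_fourier κ, mul_assoc]
  simp_rw [h1]
  -- After Fubini the phases in z combine into the Fourier transform of ρ at ξ + ζ, and the
  -- integrand becomes a multiple of the product that vanishes by `h`.
  rw [integral_integral_swap]
  · refine integral_eq_zero_of_ae (Filter.Eventually.of_forall fun p => ?_)
    have h2 : ∀ z, ρ z * ((X p.1 * e p.1 (y - z)) * (K p.2 * e p.2 (w - z))) =
        (X p.1 * K p.2 * e p.1 y * e p.2 w) * (e (p.1 + p.2) (-z) * ρ z) := fun z => by
      rw [hadd, hadd, ← hadd']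
      ring
    simp_rw [h2]
    rw [integral_const_mul]
    have h3 : ∫ z, e (p.1 + p.2) (-z) * ρ z = (𝓕 ρ : 𝓢(V, ℂ)) (p.1 + p.2) := by
      rw [SchwartzMap.fourier_coe, Real.fourier_eq']
      refine integral_congr_ae (Filter.Eventually.of_forall fun z => ?_)
      simp only [he, smul_eq_mul, inner_neg_right]
      rw [real_inner_comm]
      push_cast
      congr 2
      ring
    rw [h3]
    have := h p.1 p.2
    simp only [Pi.zero_apply]
    linear_combination (e p.1 y * e p.2 w) * this
  · have hb : Integrable (fun q : V × (V × V) => ‖ρ q.1‖ * (‖X q.2.1‖ * ‖K q.2.2‖))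
        ((volume : Measure V).prod (volume : Measure (V × V))) :=
      ρ.integrable.norm.mul_prod (X.integrable.norm.mul_prod K.integrable.norm)
    refine hb.mono' (Continuous.aestronglyMeasurable ?_) (Filter.Eventually.of_forall fun q => ?_)
    · have c1 : Continuous fun q : V × (V × V) => e q.2.1 (y - q.1) :=
        hcont.comp (by fun_prop : Continuous fun q : V × (V × V) => (q.2.1, y - q.1))
      have c2 : Continuous fun q : V × (V × V) => e q.2.2 (w - q.1) :=
        hcont.comp (by fun_prop : Continuous fun q : V × (V × V) => (q.2.2, w - q.1))
      have := ρ.continuous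
      have := X.continuous
      have := K.continuous
      simp only [Function.uncurry_def]
      fun_prop
    · simp [Function.uncurry_def, hen]

end Kernel

/-- The relation satisfied by three dyadic frequencies when a frequency of size `2 ^ a` is the sum
of frequencies of sizes `2 ^ i` and `2 ^ j`. -/
def Resonant (a i j : ℕ) : Prop := a ≤ max i j + 2 ∧ i ≤ max a j + 2 ∧ j ≤ max a i + 2

/-! ### Dyadic resolutions: telescoping, L¹ bounds, frequency supports -/

namespace IsDyadicResolution

variable {n : ℕ} {φ : ℕ → 𝓢(Rn n, ℂ)}

theorem sum_range_succ (hφ : IsDyadicResolution φ) (M : ℕ) (x : Rn n) :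
    ∑ i ∈ Finset.range (M + 1), φ i x = 2 ^ (n * M) * φ 0 ((2 : ℝ) ^ M • x) := by
  induction M with
  | zero => simp
  | succ M ih => rw [Finset.sum_range_succ, ih, hφ.succ]; ring

theorem integral_dilation {F : Type} [NormedAddCommGroup F] [NormedSpace ℝ F]
    (g : Rn n → F) (M : ℕ) :
    ∫ x, g ((2 : ℝ) ^ M • x) = ((2 : ℝ) ^ (n * M))⁻¹ • ∫ x, g x := by
  rw [Measure.integral_comp_smul]
  congr 1
  rw [finrank_euclideanSpace_fin, ← pow_mul, mul_comm M n, abs_of_pos (by positivity)]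

/-- By telescoping, a nonempty partial sum is an L¹-normalised dilate of `φ 0`, so the bound is
uniform in K. -/
theorem integral_norm_sum_le (hφ : IsDyadicResolution φ) (K : ℕ) :
    ∫ x, ‖(∑ i ∈ Finset.range K, φ i) x‖ ≤ ∫ x, ‖φ 0 x‖ := by
  rcases K with _ | M
  · simp only [Finset.range_zero, Finset.sum_empty, _root_.zero_apply, norm_zero,
      integral_zero]
    positivity
  · refine le_of_eq ?_
    simp_rw [_root_.sum_apply, hφ.sum_range_succ, norm_mul]
    rw [integral_const_mul, integral_dilation (fun x => ‖φ 0 x‖)]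
    simp

theorem integral_norm_le (hφ : IsDyadicResolution φ) (i : ℕ) :
    ∫ x, ‖φ i x‖ ≤ 2 * ∫ x, ‖φ 0 x‖ := by
  have h : ∀ x, ‖φ i x‖ ≤ ‖(∑ k ∈ Finset.range (i + 1), φ k) x‖ +
      ‖(∑ k ∈ Finset.range i, φ k) x‖ := fun x => by
    have : φ i x = (∑ k ∈ Finset.range (i + 1), φ k) x - (∑ k ∈ Finset.range i, φ k) x := by
      rw [Finset.sum_range_succ]
      simp
    rw [this]
    exact norm_sub_le _ _
  calc ∫ x, ‖φ i x‖ ≤ ∫ x, (‖(∑ k ∈ Finset.range (i + 1), φ k) x‖ +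
      ‖(∑ k ∈ Finset.range i, φ k) x‖) :=
        integral_mono (φ i).integrable.norm ((SchwartzMap.integrable _).norm.add
          (SchwartzMap.integrable _).norm) h
    _ ≤ 2 * ∫ x, ‖φ 0 x‖ := by
        rw [integral_add (SchwartzMap.integrable _).norm (SchwartzMap.integrable _).norm, two_mul]
        exact add_le_add (hφ.integral_norm_sum_le _) (hφ.integral_norm_sum_le _)

theorem fourier_sum (hφ : IsDyadicResolution φ) (M : ℕ) (ξ : Rn n) :
    (𝓕 (∑ i ∈ Finset.range (M + 1), φ i) : 𝓢(Rn n, ℂ)) ξ =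
      (𝓕 (φ 0) : 𝓢(Rn n, ℂ)) (((2 : ℝ) ^ M)⁻¹ • ξ) := by
  simp_rw [SchwartzMap.fourier_coe, Real.fourier_eq', _root_.sum_apply, hφ.sum_range_succ]
  have h : ∀ v : Rn n, Complex.exp (↑(-2 * Real.pi * inner ℝ v ξ) * Complex.I) •
      (2 ^ (n * M) * φ 0 ((2 : ℝ) ^ M • v)) = (2 ^ (n * M) : ℂ) *
      (fun v => Complex.exp (↑(-2 * Real.pi * inner ℝ v (((2 : ℝ) ^ M)⁻¹ • ξ)) * Complex.I) •
        φ 0 v) ((2 : ℝ) ^ M • v) := fun v => by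
    simp only [smul_eq_mul, inner_smul_left, inner_smul_right]
    have : ((2 : ℝ) ^ M)⁻¹ * ((starRingEnd ℝ) (2 ^ M) * inner ℝ v ξ) = inner ℝ v ξ := by
      simp
    rw [this]
    ring
  simp_rw [h]
  rw [integral_const_mul, integral_dilation (fun v => Complex.exp
    (↑(-2 * Real.pi * inner ℝ v (((2 : ℝ) ^ M)⁻¹ • ξ)) * Complex.I) • φ 0 v)]
  simp

theorem fourier_succ (hφ : IsDyadicResolution φ) (m : ℕ) (ξ : Rn n) :
    (𝓕 (φ (m + 1)) : 𝓢(Rn n, ℂ)) ξ =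
      (𝓕 (φ 0) : 𝓢(Rn n, ℂ)) (((2 : ℝ) ^ (m + 1))⁻¹ • ξ) -
        (𝓕 (φ 0) : 𝓢(Rn n, ℂ)) (((2 : ℝ) ^ m)⁻¹ • ξ) := by
  rw [← hφ.fourier_sum, ← hφ.fourier_sum, Finset.sum_range_succ _ (m + 1),
    FourierTransform.fourier_add]
  simp

theorem norm_lt_of_fourier_ne_zero (hφ : IsDyadicResolution φ) {j : ℕ} {ξ : Rn n}
    (h : (𝓕 (φ j) : 𝓢(Rn n, ℂ)) ξ ≠ 0) : ‖ξ‖ < 2 ^ (j + 1) := by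
  have h0 : ∀ {m : ℕ} {ξ : Rn n}, (𝓕 (φ 0) : 𝓢(Rn n, ℂ)) (((2 : ℝ) ^ m)⁻¹ • ξ) ≠ 0 →
      ‖ξ‖ < 2 ^ (m + 1) := fun {m ξ} h => by
    have := hφ.tsupport_fourier (subset_tsupport _ h)
    rw [mem_ball_zero_iff, norm_smul, norm_inv, norm_pow, Real.norm_ofNat,
      inv_mul_lt_iff₀ (by positivity)] at this
    rwa [pow_succ]
  rcases j with _ | m
  · exact h0 (m := 0) (by simpa using h)
  · rw [hφ.fourier_succ] at h
    by_cases h1 : (𝓕 (φ 0) : 𝓢(Rn n, ℂ)) (((2 : ℝ) ^ (m + 1))⁻¹ • ξ) = 0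
    · rw [h1, zero_sub, neg_ne_zero] at h
      exact (h0 h).trans (pow_lt_pow_right₀ one_lt_two (by lia))
    · exact h0 h1

theorem le_norm_of_fourier_ne_zero (hφ : IsDyadicResolution φ) {m : ℕ} {ξ : Rn n}
    (h : (𝓕 (φ (m + 1)) : 𝓢(Rn n, ℂ)) ξ ≠ 0) : 2 ^ m ≤ ‖ξ‖ := by
  by_contra! hlt
  apply h
  have h0 : ∀ {k : ℕ}, m ≤ k → (𝓕 (φ 0) : 𝓢(Rn n, ℂ)) (((2 : ℝ) ^ k)⁻¹ • ξ) = 1 :=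
    fun {k} hk => by
      apply hφ.fourier_eq_one
      rw [norm_smul, norm_inv, norm_pow, Real.norm_ofNat, inv_mul_lt_iff₀ (by positivity), mul_one]
      exact hlt.trans_le (pow_le_pow_right₀ one_le_two hk)
  rw [hφ.fourier_succ, h0 (by lia), h0 le_rfl, sub_self]

/-- The triangle inequality for ξ + ζ, ξ, ζ in its three arrangements. Two blocks k, l reach only
frequencies below 2^{k+1} + 2^{l+1} ≤ 2^{max k l + 2}, whereas a block b ≥ max k l + 3 lives where
the norm is at least 2^{b-1}; hence the margin 2 in `Resonant`. -/
theorem fourier_mul_mul_eq_zero (hφ : IsDyadicResolution φ) {a i j : ℕ} (h : ¬ Resonant a i j)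
    (ξ ζ : Rn n) : (𝓕 (φ a) : 𝓢(Rn n, ℂ)) (ξ + ζ) * (𝓕 (φ i) : 𝓢(Rn n, ℂ)) ξ *
      (𝓕 (φ j) : 𝓢(Rn n, ℂ)) ζ = 0 := by
  by_contra hne
  simp only [mul_eq_zero, not_or] at hne
  obtain ⟨⟨ha, hi⟩, hj⟩ := hne
  have key : ∀ {b k l : ℕ} {x y z : Rn n}, (𝓕 (φ b) : 𝓢(Rn n, ℂ)) x ≠ 0 →
      (𝓕 (φ k) : 𝓢(Rn n, ℂ)) y ≠ 0 → (𝓕 (φ l) : 𝓢(Rn n, ℂ)) z ≠ 0 →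
      ‖x‖ ≤ ‖y‖ + ‖z‖ → b ≤ max k l + 2 := by
    intro b k l x y z hb hk hl hxyz
    by_contra! hlt
    obtain ⟨m, rfl⟩ : ∃ m, b = m + 1 := ⟨b - 1, by lia⟩
    have h1 := hφ.le_norm_of_fourier_ne_zero hb
    have h2 := hφ.norm_lt_of_fourier_ne_zero hk
    have h3 := hφ.norm_lt_of_fourier_ne_zero hl
    have h4 : (2 : ℝ) ^ (k + 1) ≤ 2 ^ (max k l + 1) := pow_le_pow_right₀ one_le_two (by lia)
    have h5 : (2 : ℝ) ^ (l + 1) ≤ 2 ^ (max k l + 1) := pow_le_pow_right₀ one_le_two (by lia)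
    have h6 : (2 : ℝ) ^ (max k l + 1 + 1) ≤ 2 ^ m := pow_le_pow_right₀ one_le_two (by lia)
    rw [pow_succ _ (max k l + 1)] at h6
    linarith
  refine h ⟨key ha hi hj (norm_add_le _ _), key hi ha hj ?_, key hj ha hi ?_⟩
  · simpa using norm_sub_le (ξ + ζ) ζ
  · simpa using norm_sub_le (ξ + ζ) ξ

theorem integral_zero_eq_one (hφ : IsDyadicResolution φ) : ∫ x, φ 0 x = 1 := by
  have := hφ.fourier_eq_one 0 (by simp)
  rw [SchwartzMap.fourier_coe, Real.fourier_eq'] at this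
  simpa using this

end IsDyadicResolution

set_option linter.unusedSectionVars false

/-! ### Essential supremum and bounded representatives -/

section SupNorm

variable {G : Type} [MeasureSpace G]

/-- Measurable functions which are bounded everywhere. -/
structure BoundedMeasurable {G : Type} [MeasurableSpace G] (F : G → ℂ) : Prop where
  measurable : Measurable F
  bounded : ∃ M : ℝ, ∀ x, ‖F x‖ ≤ M

/-- The essential supremum norm of a function. -/
noncomputable def supNorm (F : G → ℂ) : ℝ≥0∞ := eLpNorm F ∞ volume

theorem ae_enorm_le_supNorm (F : G → ℂ) : ∀ᵐ x, ‖F x‖ₑ ≤ supNorm F := by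
  rw [supNorm, eLpNorm_exponent_top]
  exact enorm_ae_le_eLpNormEssSup F volume

theorem supNorm_le_of_ae {F : G → ℂ} {C : ℝ≥0∞}
    (h : ∀ᵐ x, ‖F x‖ₑ ≤ C) : supNorm F ≤ C := by
  rw [supNorm, eLpNorm_exponent_top]
  exact essSup_le_of_ae_le C h

theorem supNorm_mul_le (F H : G → ℂ) :
    supNorm (F * H) ≤ supNorm F * supNorm H := by
  apply supNorm_le_of_ae
  filter_upwards [ae_enorm_le_supNorm F, ae_enorm_le_supNorm H] with x h1 h2
  rw [Pi.mul_apply, enorm_mul]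
  gcongr

theorem supNorm_add_le (F H : G → ℂ) :
    supNorm (F + H) ≤ supNorm F + supNorm H := by
  apply supNorm_le_of_ae
  filter_upwards [ae_enorm_le_supNorm F, ae_enorm_le_supNorm H] with x h1 h2
  exact (enorm_add_le _ _).trans (add_le_add h1 h2)

theorem supNorm_zero : supNorm (0 : G → ℂ) = 0 := by
  simp [supNorm]

theorem supNorm_sum_le {ι : Type} (s : Finset ι) (F : ι → G → ℂ) :
    supNorm (∑ i ∈ s, F i) ≤ ∑ i ∈ s, supNorm (F i) := by
  classical
  induction s using Finset.induction_on with
  | empty => simp [supNorm_zero]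
  | insert i s hi ih =>
    rw [Finset.sum_insert hi, Finset.sum_insert hi]
    exact (supNorm_add_le _ _).trans (add_le_add le_rfl ih)

namespace BoundedMeasurable

variable {F H : G → ℂ}

theorem mul (hF : BoundedMeasurable F) (hH : BoundedMeasurable H) : BoundedMeasurable (F * H) := by
  obtain ⟨M, hM⟩ := hF.bounded
  obtain ⟨M', hM'⟩ := hH.bounded
  refine ⟨hF.measurable.mul hH.measurable, M * M', fun x => ?_⟩
  rw [Pi.mul_apply, norm_mul]
  have := (norm_nonneg _).trans (hM x)
  gcongr
  exacts [hM x, hM' x]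

theorem sub (hF : BoundedMeasurable F) (hH : BoundedMeasurable H) : BoundedMeasurable (F - H) := by
  obtain ⟨M, hM⟩ := hF.bounded
  obtain ⟨M', hM'⟩ := hH.bounded
  exact ⟨hF.measurable.sub hH.measurable, M + M',
    fun x => (norm_sub_le _ _).trans (add_le_add (hM x) (hM' x))⟩

theorem add (hF : BoundedMeasurable F) (hH : BoundedMeasurable H) : BoundedMeasurable (F + H) := by
  obtain ⟨M, hM⟩ := hF.bounded
  obtain ⟨M', hM'⟩ := hH.bounded
  exact ⟨hF.measurable.add hH.measurable, M + M',
    fun x => (norm_add_le _ _).trans (add_le_add (hM x) (hM' x))⟩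

theorem zero : BoundedMeasurable (0 : G → ℂ) := ⟨measurable_const, 0, fun x => by simp⟩

theorem sum {ι : Type} (s : Finset ι) {F : ι → G → ℂ} (hF : ∀ i, BoundedMeasurable (F i)) :
    BoundedMeasurable (∑ i ∈ s, F i) := by
  classical
  induction s using Finset.induction_on with
  | empty => simpa using zero
  | insert i s hi ih =>
    rw [Finset.sum_insert hi]
    exact (hF i).add ih

theorem memLp (hF : BoundedMeasurable F) : MemLp F ∞ volume := by
  obtain ⟨M, hM⟩ := hF.bounded
  exact memLp_top_of_bound hF.measurable.aestronglyMeasurable M (Filter.Eventually.of_forall hM)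

theorem supNorm_ne_top (hF : BoundedMeasurable F) : supNorm F ≠ ∞ := hF.memLp.eLpNorm_ne_top

/-- Every class in `L^∞` has an everywhere bounded measurable representative. -/
theorem exists_rep (F : Lp ℂ ∞ (volume : Measure G)) :
    ∃ F' : G → ℂ, BoundedMeasurable F' ∧ ∀ᵐ x, F x = F' x := by
  have hm := Lp.stronglyMeasurable F
  have hs : MeasurableSet {x | ‖F x‖ ≤ ‖F‖} := measurableSet_le hm.measurable.norm measurable_const
  -- F is set to zero on the null set where it exceeds its norm. A bound valid everywhere keeps the
  -- later Fubini arguments for F(x - L z) free of exceptional sets.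
  refine ⟨{x | ‖F x‖ ≤ ‖F‖}.indicator F, ⟨hm.measurable.indicator hs, ‖F‖, fun x => ?_⟩, ?_⟩
  · by_cases hx : x ∈ {x | ‖F x‖ ≤ ‖F‖}
    · rw [Set.indicator_of_mem hx]; exact hx
    · rw [Set.indicator_of_notMem hx]; simp
  · have h := ae_enorm_le_supNorm (F : G → ℂ)
    have h2 : supNorm (F : G → ℂ) = ‖F‖ₑ := (Lp.enorm_def F).symm
    filter_upwards [h] with x hx
    rw [Set.indicator_of_mem]
    rw [h2] at hx
    exact enorm_le_iff_norm_le.1 hx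

end BoundedMeasurable

end SupNorm

/-! ### Partial convolutions of bounded functions -/

section Convolution

variable {G : Type} [NormedAddCommGroup G] [NormedSpace ℝ G] [FiniteDimensional ℝ G]
  [MeasureSpace G] [BorelSpace G] [(volume : Measure G).IsAddHaarMeasure]
variable {V : Type} [NormedAddCommGroup V] [InnerProductSpace ℝ V] [FiniteDimensional ℝ V]
  [MeasurableSpace V] [BorelSpace V]
variable {W : Type} [NormedAddCommGroup W] [InnerProductSpace ℝ W] [FiniteDimensional ℝ W]
  [MeasurableSpace W] [BorelSpace W]

/-- The convolution `x ↦ ∫ ρ(z) F(x - L z) dz` along a linear map `L`. -/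
noncomputable def conv (L : V →L[ℝ] G) (ρ : 𝓢(V, ℂ)) (F : G → ℂ) (x : G) : ℂ := ∫ z, ρ z * F (x - L z)

variable {F H : G → ℂ}

theorem integrable_conv (L : V →L[ℝ] G) (ρ : 𝓢(V, ℂ)) (hF : BoundedMeasurable F) (x : G) :
    Integrable (fun z => ρ z * F (x - L z)) := by
  obtain ⟨M, hM⟩ := hF.bounded
  refine (ρ.integrable.norm.mul_const M).mono' ?_ (Filter.Eventually.of_forall fun z => ?_)
  · exact (ρ.continuous.measurable.mul
      (hF.measurable.comp (by fun_prop))).aestronglyMeasurable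
  · rw [norm_mul]
    gcongr
    exact hM _

theorem BoundedMeasurable.conv (L : V →L[ℝ] G) (ρ : 𝓢(V, ℂ)) (hF : BoundedMeasurable F) :
    BoundedMeasurable (conv L ρ F) := by
  obtain ⟨M, hM⟩ := hF.bounded
  refine ⟨?_, (∫ z, ‖ρ z‖) * M, fun x => ?_⟩
  · have h : Measurable (fun p : G × V => ρ p.2 * F (p.1 - L p.2)) :=
      (ρ.continuous.measurable.comp measurable_snd).mul (hF.measurable.comp (by fun_prop))
    exact (h.stronglyMeasurable.integral_prod_right (ν := (volume : Measure V))).measurable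
  · rw [← integral_mul_const]
    refine norm_integral_le_of_norm_le (ρ.integrable.norm.mul_const M)
      (Filter.Eventually.of_forall fun z => ?_)
    rw [norm_mul]
    gcongr
    exact hM _

theorem conv_sub (L : V →L[ℝ] G) (ρ : 𝓢(V, ℂ)) (hF : BoundedMeasurable F)
    (hH : BoundedMeasurable H) : conv L ρ (F - H) = conv L ρ F - conv L ρ H := by
  ext x
  simp only [conv, Pi.sub_apply, mul_sub]
  exact integral_sub (integrable_conv L ρ hF x) (integrable_conv L ρ hH x)

theorem conv_add (L : V →L[ℝ] G) (ρ : 𝓢(V, ℂ)) (hF : BoundedMeasurable F)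
    (hH : BoundedMeasurable H) : conv L ρ (F + H) = conv L ρ F + conv L ρ H := by
  ext x
  simp only [conv, Pi.add_apply, mul_add]
  exact integral_add (integrable_conv L ρ hF x) (integrable_conv L ρ hH x)

theorem conv_zero (L : V →L[ℝ] G) (ρ : 𝓢(V, ℂ)) : conv L ρ (0 : G → ℂ) = 0 := by
  ext x
  simp [conv]

theorem conv_sum {ι : Type} (L : V →L[ℝ] G) (ρ : 𝓢(V, ℂ)) (s : Finset ι) {F : ι → G → ℂ}
    (hF : ∀ i, BoundedMeasurable (F i)) : conv L ρ (∑ i ∈ s, F i) = ∑ i ∈ s, conv L ρ (F i) := by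
  ext x
  simp only [conv, Finset.sum_apply, Finset.mul_sum]
  exact integral_finsetSum s fun i _ => integrable_conv L ρ (hF i) x

theorem conv_sum_left {ι : Type} (L : V →L[ℝ] G) (s : Finset ι) (ρ : ι → 𝓢(V, ℂ))
    (hF : BoundedMeasurable F) : conv L (∑ i ∈ s, ρ i) F = ∑ i ∈ s, conv L (ρ i) F := by
  ext x
  simp only [conv, Finset.sum_apply, _root_.sum_apply, Finset.sum_mul]
  exact integral_finsetSum s fun i _ => integrable_conv L (ρ i) hF x

/-- Young's inequality for convolution with a Schwartz function in some of the variables. -/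
theorem supNorm_conv_le (L : V →L[ℝ] G) (ρ : 𝓢(V, ℂ)) (hF : BoundedMeasurable F) :
    supNorm (conv L ρ F) ≤ ENNReal.ofReal (∫ z, ‖ρ z‖) * supNorm F := by
  set s : Set G := {x | ‖F x‖ₑ ≤ supNorm F}ᶜ
  have hs : MeasurableSet s :=
    (measurableSet_le hF.measurable.enorm measurable_const).compl
  have hs0 : volume s = 0 := ae_enorm_le_supNorm F
  -- For each fixed z the translate of a null set is null; Fubini exchanges the quantifiers.
  have hnull : ∀ᵐ x, ∀ᵐ z, x - L z ∉ s := by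
    have hm : Measurable (fun p : G × V => p.1 - L p.2) := by fun_prop
    rw [Measure.ae_ae_comm (p := fun (x : G) (z : V) => x - L z ∉ s) (hm hs.compl)]
    refine Filter.Eventually.of_forall fun z => ?_
    have := (measurePreserving_sub_right (volume : Measure G) (L z)).quasiMeasurePreserving.ae
      (p := fun x => x ∉ s) (measure_eq_zero_iff_ae_notMem.1 hs0)
    exact this
  apply supNorm_le_of_ae
  filter_upwards [hnull] with x hx
  calc ‖conv L ρ F x‖ₑ ≤ ∫⁻ z, ‖ρ z * F (x - L z)‖ₑ := enorm_integral_le_lintegral_enorm _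
    _ ≤ ∫⁻ z, ‖ρ z‖ₑ * supNorm F := by
      refine lintegral_mono_ae ?_
      filter_upwards [hx] with z hz
      rw [enorm_mul]
      gcongr
      simpa [s] using hz
    _ = ENNReal.ofReal (∫ z, ‖ρ z‖) * supNorm F := by
      rw [lintegral_mul_const _ ρ.continuous.measurable.enorm,
        ofReal_integral_norm_eq_lintegral_enorm ρ.integrable]

theorem conv_comm (L : V →L[ℝ] G) (ρ : 𝓢(V, ℂ)) (L' : W →L[ℝ] G) (σ : 𝓢(W, ℂ))
    (hF : BoundedMeasurable F) : conv L ρ (conv L' σ F) = conv L' σ (conv L ρ F) := by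
  obtain ⟨M, hM⟩ := hF.bounded
  ext x
  simp only [conv, ← integral_const_mul]
  rw [integral_integral_swap]
  · refine integral_congr_ae (Filter.Eventually.of_forall fun w => ?_)
    refine integral_congr_ae (Filter.Eventually.of_forall fun z => ?_)
    simp only [sub_right_comm x]
    ring
  · refine ((ρ.integrable.norm.mul_prod σ.integrable.norm).mul_const M).mono' ?_
      (Filter.Eventually.of_forall fun p => ?_)
    · exact ((ρ.continuous.measurable.comp measurable_fst).mul
        ((σ.continuous.measurable.comp measurable_snd).mul
          (hF.measurable.comp (by fun_prop)))).aestronglyMeasurable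
    · simp only [Function.uncurry_def, norm_mul, ← mul_assoc]
      gcongr
      exact hM _

/-- Products of frequency localised functions are frequency localised. -/
theorem conv_mul_conv_eq_zero (L : V →L[ℝ] G) (ρ χ κ : 𝓢(V, ℂ))
    (h : ∀ ξ ζ : V, (𝓕 ρ : 𝓢(V, ℂ)) (ξ + ζ) * (𝓕 χ : 𝓢(V, ℂ)) ξ * (𝓕 κ : 𝓢(V, ℂ)) ζ = 0)
    (hF : BoundedMeasurable F) (hH : BoundedMeasurable H) :
    conv L ρ (conv L χ F * conv L κ H) = 0 := by
  obtain ⟨M, hM⟩ := hF.bounded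
  obtain ⟨M', hM'⟩ := hH.bounded
  ext x
  -- The substitution y ↦ y - z moves z from the bounded function into the Schwartz kernel, where
  -- the Fourier argument applies.
  have hshift : ∀ (σ : 𝓢(V, ℂ)) (K : G → ℂ) (z : V),
      conv L σ K (x - L z) = ∫ y, σ (y - z) * K (x - L y) := fun σ K z => by
    rw [conv, ← integral_sub_right_eq_self (μ := volume) _ z]
    simp
  have h1 : ∀ z, ρ z * (conv L χ F * conv L κ H) (x - L z) = ∫ p : V × V,
      ρ z * ((χ (p.1 - z) * F (x - L p.1)) * (κ (p.2 - z) * H (x - L p.2))) := fun z => by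
    rw [integral_const_mul, Measure.volume_eq_prod,
      integral_prod_mul (fun y => χ (y - z) * F (x - L y)) (fun w => κ (w - z) * H (x - L w)),
      Pi.mul_apply, hshift, hshift]
  rw [conv]
  simp_rw [h1]
  rw [integral_integral_swap]
  · refine integral_eq_zero_of_ae (Filter.Eventually.of_forall fun p => ?_)
    have h2 : ∀ z, ρ z * ((χ (p.1 - z) * F (x - L p.1)) * (κ (p.2 - z) * H (x - L p.2))) =
        (F (x - L p.1) * H (x - L p.2)) * (ρ z * χ (p.1 - z) * κ (p.2 - z)) := fun z => by ring
    simp_rw [h2]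
    rw [integral_const_mul, integral_mul_mul_eq_zero ρ χ κ h]
    simp
  · have hb : Integrable (fun q : V × (V × V) => (‖ρ q.1‖ * (‖χ (q.2.1 - q.1)‖ *
        ‖κ (q.2.2 - q.1)‖)) * (M * M')) (volume.prod volume) := by
      refine Integrable.mul_const ?_ _
      have hc : Continuous fun q : V × (V × V) => ‖ρ q.1‖ * (‖χ (q.2.1 - q.1)‖ *
          ‖κ (q.2.2 - q.1)‖) := by
        have := ρ.continuous
        have := χ.continuous
        have := κ.continuous
        fun_prop
      refine (integrable_prod_iff hc.aestronglyMeasurable).2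
        ⟨Filter.Eventually.of_forall fun z => ?_, ?_⟩
      · exact (((χ.integrable (μ := volume)).comp_sub_right z).norm.mul_prod
          ((κ.integrable (μ := volume)).comp_sub_right z).norm).const_mul ‖ρ z‖
      · have h3 : ∀ z, ∫ p : V × V, ‖‖ρ z‖ * (‖χ (p.1 - z)‖ * ‖κ (p.2 - z)‖)‖ =
            ‖ρ z‖ * ((∫ y, ‖χ y‖) * ∫ w, ‖κ w‖) := fun z => by
          simp only [norm_mul, norm_norm]
          rw [integral_const_mul, Measure.volume_eq_prod,
            integral_prod_mul (fun y => ‖χ (y - z)‖) (fun w => ‖κ (w - z)‖),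
            integral_sub_right_eq_self (μ := volume) (fun y => ‖χ y‖) z,
            integral_sub_right_eq_self (μ := volume) (fun y => ‖κ y‖) z]
        simp_rw [h3]
        exact ρ.integrable.norm.mul_const _
    refine hb.mono' ?_ (Filter.Eventually.of_forall fun q => ?_)
    · have mF : Measurable fun q : V × (V × V) => F (x - L q.2.1) :=
        hF.measurable.comp (by fun_prop)
      have mH : Measurable fun q : V × (V × V) => H (x - L q.2.2) :=
        hH.measurable.comp (by fun_prop)
      have m1 := ρ.continuous.measurable
      have m2 := χ.continuous.measurable
      have m3 := κ.continuous.measurable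
      refine Measurable.aestronglyMeasurable ?_
      simp only [Function.uncurry_def]
      exact (m1.comp (by fun_prop)).mul (((m2.comp (by fun_prop)).mul mF).mul
        ((m3.comp (by fun_prop)).mul mH))
    · have hM0 : 0 ≤ M := (norm_nonneg _).trans (hM 0)
      simp only [Function.uncurry_def, norm_mul]
      calc _ ≤ ‖ρ q.1‖ * (‖χ (q.2.1 - q.1)‖ * M * (‖κ (q.2.2 - q.1)‖ * M')) := by
            gcongr
            exacts [hM _, hM' _]
        _ = _ := by ring

theorem IsDyadicResolution.conv_mul_conv_eq_zero {n : ℕ} {φ : ℕ → 𝓢(Rn n, ℂ)}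
    (hφ : IsDyadicResolution φ) (L : Rn n →L[ℝ] G) {a i j : ℕ} (h : ¬ Resonant a i j)
    (hF : BoundedMeasurable F) (hH : BoundedMeasurable H) :
    conv L (φ a) (conv L (φ i) F * conv L (φ j) H) = 0 :=
  BiHolder.conv_mul_conv_eq_zero L _ _ _ (hφ.fourier_mul_mul_eq_zero h) hF hH

end Convolution

/-! ### Approximate identities in the Schwartz topology -/

section ApproximateIdentity

variable {E G : Type} [NormedAddCommGroup E] [NormedSpace ℝ E] [FiniteDimensional ℝ E]
  [MeasureSpace E] [BorelSpace E] [(volume : Measure E).IsAddHaarMeasure]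
  [NormedAddCommGroup G] [NormedSpace ℝ G]

/-- Since ρ has mass one, the difference is ∫ ρ(z)(h(x + L z) - h(x)) dz, and the mean value
inequality on the segment gives the case n = 0. Averaging commutes with differentiation, so the
induction replaces h by its derivative; this is why the target space Y varies. -/
theorem norm_iteratedFDeriv_avgFun_sub_le (L : E →L[ℝ] G) (ρ : 𝓢(E, ℂ)) (hρ : ∫ z, ρ z = 1)
    (x : G) (b : E → ℝ) (hb : Integrable fun z => ‖ρ z‖ * b z) (n : ℕ) :
    ∀ {Y : Type} [NormedAddCommGroup Y] [NormedSpace ℝ Y] [NormedSpace ℂ Y] [SMulCommClass ℝ ℂ Y]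
      [CompleteSpace Y] (h : 𝓢(G, Y)),
      (∀ z, ∀ t ∈ Set.Icc (0 : ℝ) 1, ‖iteratedFDeriv ℝ (n + 1) h (x + t • L z)‖ * ‖L z‖ ≤ b z) →
      ‖iteratedFDeriv ℝ n (avgFun L ρ h - ⇑h) x‖ ≤ ∫ z, ‖ρ z‖ * b z := by
  induction n with
  | zero =>
    intro Y _ _ _ _ _ h hbd
    have h1 : (avgFun L ρ h - ⇑h) x = ∫ z, ρ z • (h (x + L z) - h x) := by
      simp only [smul_sub]
      rw [integral_sub (integrable_avg L ρ h x) (ρ.integrable.smul_const _), integral_smul_const,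
        hρ, one_smul]
      rfl
    rw [norm_iteratedFDeriv_zero, h1]
    refine norm_integral_le_of_norm_le hb (Filter.Eventually.of_forall fun z => ?_)
    rw [norm_smul]
    gcongr
    -- The derivative bound along the segment is `b z / ‖L z‖`, so the degenerate case is separate.
    rcases eq_or_ne (L z) 0 with hz | hz
    · have := hbd z 0 (by simp)
      simpa [hz] using this
    have hpos : 0 < ‖L z‖ := norm_pos_iff.2 hz
    have := Convex.norm_image_sub_le_of_norm_fderiv_le (𝕜 := ℝ) (f := h) (C := b z / ‖L z‖)
      (s := segment ℝ x (x + L z)) (x := x) (y := x + L z)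
      (fun y _ => h.differentiableAt) (fun y hy => ?_) (convex_segment _ _)
      (left_mem_segment _ _ _) (right_mem_segment _ _ _)
    · simpa [div_mul_cancel₀ _ hpos.ne'] using this
    · rw [segment_eq_image'] at hy
      obtain ⟨t, ht, rfl⟩ := hy
      rw [le_div_iff₀ hpos, ← norm_iteratedFDeriv_one]
      simpa using hbd z t ht
  | succ n ih =>
    intro Y _ _ _ _ _ h hbd
    have h2 : (SchwartzMap.fderivCLM ℝ G Y h : G → G →L[ℝ] Y) = fderiv ℝ h :=
      funext fun y => SchwartzMap.fderivCLM_apply ℝ h y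
    have h1 : fderiv ℝ (avgFun L ρ h - ⇑h) =
        avgFun L ρ (SchwartzMap.fderivCLM ℝ G Y h) - ⇑(SchwartzMap.fderivCLM ℝ G Y h) :=
      funext fun y => by
        rw [fderiv_sub (hasFDerivAt_avgFun L ρ h y).differentiableAt h.differentiableAt,
          (hasFDerivAt_avgFun L ρ h y).fderiv, Pi.sub_apply, SchwartzMap.fderivCLM_apply]
    have h3 := ih (SchwartzMap.fderivCLM ℝ G Y h) fun z t ht => by
      rw [h2, norm_iteratedFDeriv_fderiv]
      exact hbd z t ht
    rwa [← h1, norm_iteratedFDeriv_fderiv] at h3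

theorem integrable_mul_one_add_pow (ρ : 𝓢(E, ℂ)) (k : ℕ) :
    Integrable (fun z => ‖ρ z‖ * (1 + ‖z‖) ^ k) := by
  simp only [add_comm (1 : ℝ), add_pow, one_pow, mul_one, Finset.mul_sum]
  refine integrable_finsetSum _ fun m _ => ?_
  refine ((ρ.integrable_pow_mul volume m).mul_const (k.choose m : ℝ)).congr
    (Filter.Eventually.of_forall fun z => ?_)
  ring

/-- C is chosen before L, and Λ only caps the size of L, so the factor ‖L‖ makes the seminorm of the
difference vanish as L → 0. -/
theorem avgFun_sub_decay (ρ : 𝓢(E, ℂ)) (hρ : ∫ z, ρ z = 1) (h : 𝓢(G, ℂ)) (k n : ℕ) :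
    ∃ C : ℝ, 0 ≤ C ∧ ∀ (L : E →L[ℝ] G) (Λ : ℝ), 0 ≤ Λ → ‖L‖ ≤ Λ → ∀ x : G,
      ‖x‖ ^ k * ‖iteratedFDeriv ℝ n (avgFun L ρ h - ⇑h) x‖ ≤ ‖L‖ * ((1 + Λ) ^ k * C) := by
  set S := ((Finset.Iic (k, n + 1)).sup (schwartzSeminormFamily ℂ G ℂ)) h with hS
  have hS0 : 0 ≤ S := apply_nonneg _ _
  refine ⟨(∫ z, ‖ρ z‖ * (1 + ‖z‖) ^ (k + 1)) * (2 ^ k * S), by positivity, ?_⟩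
  intro L Λ hΛ hL x
  have hx0 : 0 < (1 + ‖x‖) ^ k := by positivity
  set c : ℝ := ‖L‖ * (1 + Λ) ^ k * (2 ^ k * S) / (1 + ‖x‖) ^ k with hc
  have hb := norm_iteratedFDeriv_avgFun_sub_le L ρ hρ x (fun z => (1 + ‖z‖) ^ (k + 1) * c)
    (by simpa only [mul_assoc] using (integrable_mul_one_add_pow ρ (k + 1)).mul_const c) n h
    fun z t ht => by
      have hLz : ‖L z‖ ≤ ‖L‖ * ‖z‖ := L.le_opNorm z
      have hLz' : ‖L z‖ ≤ Λ * ‖z‖ := hLz.trans (by gcongr)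
      have hS1 : (1 + ‖x + t • L z‖) ^ k * ‖iteratedFDeriv ℝ (n + 1) h (x + t • L z)‖ ≤ 2 ^ k * S :=
        SchwartzMap.one_add_le_sup_seminorm_apply (𝕜 := ℂ) (m := (k, n + 1)) le_rfl le_rfl h _
      -- A Peetre-type inequality: the weight moves from x to x + t • L z at the cost of a
      -- polynomial in ‖z‖, which the decay of ρ absorbs.
      have hx : 1 + ‖x‖ ≤ (1 + ‖x + t • L z‖) * ((1 + Λ) * (1 + ‖z‖)) := by
        have h1 : ‖x‖ ≤ ‖x + t • L z‖ + ‖t • L z‖ := by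
          simpa using norm_sub_le (x + t • L z) (t • L z)
        have h2 : ‖t • L z‖ ≤ Λ * ‖z‖ := by
          rw [norm_smul, Real.norm_eq_abs, abs_of_nonneg ht.1]
          nlinarith [ht.2, norm_nonneg (L z)]
        have h3 := norm_nonneg (x + t • L z)
        have h4 := norm_nonneg z
        have h5 := mul_nonneg hΛ h4
        have h6 := mul_nonneg h3 (add_nonneg (add_nonneg hΛ h4) h5)
        nlinarith
      have h7 : (1 + ‖x‖) ^ k * ‖iteratedFDeriv ℝ (n + 1) h (x + t • L z)‖ ≤
          ((1 + Λ) * (1 + ‖z‖)) ^ k * (2 ^ k * S) := by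
        calc _ ≤ ((1 + ‖x + t • L z‖) * ((1 + Λ) * (1 + ‖z‖))) ^ k *
              ‖iteratedFDeriv ℝ (n + 1) h (x + t • L z)‖ := by gcongr
          _ = ((1 + Λ) * (1 + ‖z‖)) ^ k * ((1 + ‖x + t • L z‖) ^ k *
              ‖iteratedFDeriv ℝ (n + 1) h (x + t • L z)‖) := by rw [mul_pow]; ring
          _ ≤ _ := by gcongr
      have h8 : ‖iteratedFDeriv ℝ (n + 1) h (x + t • L z)‖ ≤
          ((1 + Λ) * (1 + ‖z‖)) ^ k * (2 ^ k * S) / (1 + ‖x‖) ^ k := by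
        rw [le_div_iff₀ hx0, mul_comm]
        exact h7
      calc _ ≤ ((1 + Λ) * (1 + ‖z‖)) ^ k * (2 ^ k * S) / (1 + ‖x‖) ^ k *
            (‖L‖ * (1 + ‖z‖)) := by
            gcongr
            exact hLz.trans (by gcongr; linarith)
        _ = _ := by rw [hc, mul_pow]; ring
  simp_rw [← mul_assoc] at hb
  rw [integral_mul_const] at hb
  calc _ ≤ (1 + ‖x‖) ^ k * ((∫ z, ‖ρ z‖ * (1 + ‖z‖) ^ (k + 1)) * c) := by
        gcongr
        linarith
    _ = _ := by rw [hc]; field_simp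

theorem tendsto_avgCLM (ρ : 𝓢(E, ℂ)) (hρ : ∫ z, ρ z = 1) (h : 𝓢(G, ℂ)) {L : ℕ → E →L[ℝ] G}
    (hL : Filter.Tendsto L Filter.atTop (nhds 0)) :
    Filter.Tendsto (fun M => avgCLM (L M) ρ h) Filter.atTop (nhds h) := by
  rw [(schwartz_withSeminorms ℂ G ℂ).tendsto_nhds]
  rintro ⟨k, n⟩ ε hε
  obtain ⟨C, hC, hbd⟩ := avgFun_sub_decay ρ hρ h k n
  have hL0 : Filter.Tendsto (fun M => ‖L M‖) Filter.atTop (nhds 0) := by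
    simpa using hL.norm
  have hlim : Filter.Tendsto (fun M => ‖L M‖ * ((1 + 1) ^ k * C)) Filter.atTop (nhds 0) := by
    simpa using hL0.mul_const ((1 + 1) ^ k * C)
  filter_upwards [hL0.eventually_le_const one_pos, hlim.eventually_lt_const hε] with M h1 h2
  refine lt_of_le_of_lt ?_ h2
  exact SchwartzMap.seminorm_le_bound ℂ k n _ (by positivity) (hbd (L M) 1 zero_le_one h1)

end ApproximateIdentity

/-- The partial sum is a dilate of `φ 0`, and a change of variables moves the dilation onto L.
Adding more blocks thus amounts to letting the linear map tend to 0, the setting of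
`tendsto_avgCLM`. -/
theorem IsDyadicResolution.avgCLM_sum {n : ℕ} {φ : ℕ → 𝓢(Rn n, ℂ)} (hφ : IsDyadicResolution φ)
    {G : Type} [NormedAddCommGroup G] [NormedSpace ℝ G] (L : Rn n →L[ℝ] G) (M : ℕ) (h : 𝓢(G, ℂ)) :
    avgCLM L (∑ i ∈ Finset.range (M + 1), φ i) h = avgCLM (((2 : ℝ) ^ M)⁻¹ • L) (φ 0) h := by
  ext x
  rw [avgCLM_apply, avgCLM_apply]
  have h1 : ∀ z, (∑ i ∈ Finset.range (M + 1), φ i) z * h (x + L z) = (2 ^ (n * M) : ℂ) *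
      (fun z => φ 0 z * h (x + (((2 : ℝ) ^ M)⁻¹ • L) z)) ((2 : ℝ) ^ M • z) := fun z => by
    rw [_root_.sum_apply, hφ.sum_range_succ]
    simp only [_root_.smul_apply, map_smul]
    rw [smul_smul, mul_inv_cancel₀ (by positivity), one_smul, mul_assoc]
  simp_rw [h1]
  rw [integral_const_mul, integral_dilation (fun z => φ 0 z * h (x + (((2 : ℝ) ^ M)⁻¹ • L) z))]
  simp

/-! ### Littlewood-Paley decomposition of distributions and of bounded functions -/

section Distributions

variable {G : Type} [NormedAddCommGroup G] [NormedSpace ℝ G] [FiniteDimensional ℝ G]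
  [MeasureSpace G] [BorelSpace G] [(volume : Measure G).IsAddHaarMeasure]
variable {V : Type} [NormedAddCommGroup V] [InnerProductSpace ℝ V] [FiniteDimensional ℝ V]
  [MeasurableSpace V] [BorelSpace V]
variable {n : ℕ} {φ : ℕ → 𝓢(Rn n, ℂ)} {F : G → ℂ}

/-- The convolution of a tempered distribution with a Schwartz function along a linear map. -/
noncomputable def convDist (L : V →L[ℝ] G) (ρ : 𝓢(V, ℂ)) (f : 𝓢'(G, ℂ)) : 𝓢'(G, ℂ) :=
  PointwiseConvergenceCLM.precomp ℂ (avgCLM L ρ) f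

theorem convDist_apply (L : V →L[ℝ] G) (ρ : 𝓢(V, ℂ)) (f : 𝓢'(G, ℂ)) (h : 𝓢(G, ℂ)) :
    convDist L ρ f h = f (avgCLM L ρ h) := rfl

/-- The class in `L^∞` of a bounded measurable function. -/
noncomputable def BoundedMeasurable.toLp (hF : BoundedMeasurable F) : Lp ℂ ∞ (volume : Measure G) :=
  hF.memLp.toLp F

/-- The tempered distribution given by a bounded measurable function. -/
noncomputable def BoundedMeasurable.toDist (hF : BoundedMeasurable F) : 𝓢'(G, ℂ) :=
  Lp.toTemperedDistribution hF.toLp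

theorem BoundedMeasurable.coeFn_toLp (hF : BoundedMeasurable F) : ∀ᵐ x, hF.toLp x = F x :=
  hF.memLp.coeFn_toLp

theorem BoundedMeasurable.enorm_toLp (hF : BoundedMeasurable F) : ‖hF.toLp‖ₑ = supNorm F :=
  Lp.enorm_toLp hF.memLp

theorem BoundedMeasurable.toDist_apply (hF : BoundedMeasurable F) (h : 𝓢(G, ℂ)) :
    hF.toDist h = ∫ x, h x * F x := by
  rw [toDist, Lp.toTemperedDistribution_apply]
  refine integral_congr_ae ?_
  filter_upwards [hF.coeFn_toLp] with x hx
  rw [hx, smul_eq_mul]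

theorem toTemperedDistribution_injective :
    Function.Injective
      (Lp.toTemperedDistribution : Lp ℂ ∞ (volume : Measure G) → 𝓢'(G, ℂ)) := by
  have h := Lp.ker_toTemperedDistributionCLM_eq_bot (F := ℂ) (μ := (volume : Measure G)) (p := ∞)
  exact LinearMap.ker_eq_bot.1 h

/-- Averaging over x + L z and convolving over x - L z are transposes of each other: Fubini followed
by a translation by L z. -/
theorem convDist_toDist (L : V →L[ℝ] G) (ρ : 𝓢(V, ℂ)) (hF : BoundedMeasurable F) :
    convDist L ρ hF.toDist = (hF.conv L ρ).toDist := by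
  obtain ⟨M, hM⟩ := hF.bounded
  have hM0 : 0 ≤ M := (norm_nonneg _).trans (hM 0)
  ext h
  have mh := h.continuous.measurable
  have mρ := ρ.continuous.measurable
  rw [convDist_apply, BoundedMeasurable.toDist_apply, BoundedMeasurable.toDist_apply]
  simp only [avgCLM_apply, conv, ← integral_const_mul, ← integral_mul_const]
  have hswap : ∀ K : G → V → ℂ, Measurable (Function.uncurry K) →
      (∀ z, ∀ x, ‖K x z‖ ≤ ‖ρ z‖ * ‖h x‖ * M) →
      Integrable (Function.uncurry K) (volume.prod volume) := fun K hK hb => by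
    refine ((h.integrable.norm.mul_prod ρ.integrable.norm).mul_const M).mono'
      hK.aestronglyMeasurable (Filter.Eventually.of_forall fun p => ?_)
    rw [mul_comm ‖h p.1‖]
    exact hb p.2 p.1
  -- With h evaluated at x + L z the natural bound is not a product in x and z, so integrability is
  -- checked through iterated integrals and translation invariance.
  have hshear : Integrable (Function.uncurry fun (x : G) (z : V) => ρ z * h (x + L z) * F x)
      (volume.prod volume) := by
    have hm : Measurable (Function.uncurry fun (x : G) (z : V) => ρ z * h (x + L z) * F x) :=
      ((mρ.comp measurable_snd).mul (mh.comp (by fun_prop))).mul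
        (hF.measurable.comp measurable_fst)
    refine (integrable_prod_iff' hm.aestronglyMeasurable).2
      ⟨Filter.Eventually.of_forall fun z => ?_, ?_⟩
    · refine (((h.integrable (μ := volume)).comp_add_right (L z)).norm.const_mul
        (‖ρ z‖ * M)).mono' (hm.comp (by fun_prop)).aestronglyMeasurable
        (Filter.Eventually.of_forall fun x => ?_)
      simp only [Function.uncurry_def, norm_mul]
      have := hM x
      calc _ ≤ ‖ρ z‖ * ‖h (x + L z)‖ * M := by gcongr
        _ = _ := by ring
    · refine (ρ.integrable.norm.mul_const (M * ∫ x, ‖h x‖)).mono'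
        (hm.norm.stronglyMeasurable.integral_prod_left (μ := volume)).aestronglyMeasurable
        (Filter.Eventually.of_forall fun z => ?_)
      rw [← integral_add_right_eq_self (μ := volume) (fun x => ‖h x‖) (L z), ← mul_assoc,
        ← integral_const_mul]
      refine norm_integral_le_of_norm_le
        (((h.integrable (μ := volume)).comp_add_right (L z)).norm.const_mul (‖ρ z‖ * M))
        (Filter.Eventually.of_forall fun x => ?_)
      simp only [Function.uncurry_def, norm_mul, norm_norm]
      have := hM x
      calc _ ≤ ‖ρ z‖ * ‖h (x + L z)‖ * M := by gcongr
        _ = _ := by ring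
  rw [integral_integral_swap hshear, integral_integral_swap (hswap _ ?_ ?_)]
  · refine integral_congr_ae (Filter.Eventually.of_forall fun z => ?_)
    simp only
    rw [← integral_sub_right_eq_self (μ := volume) _ (L z)]
    refine integral_congr_ae (Filter.Eventually.of_forall fun x => ?_)
    simp only [sub_add_cancel]
    ring
  · exact (mh.comp measurable_fst).mul ((mρ.comp measurable_snd).mul
      (hF.measurable.comp (by fun_prop)))
  · intro z x
    rw [norm_mul, norm_mul]
    have := hM (x - L z)
    calc _ ≤ ‖h x‖ * (‖ρ z‖ * M) := by gcongr
      _ = _ := by ring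

/-- The Littlewood-Paley decomposition of a tempered distribution in some of the variables. -/
theorem IsDyadicResolution.tendsto_sum_convDist (hφ : IsDyadicResolution φ) (L : Rn n →L[ℝ] G)
    (f : 𝓢'(G, ℂ)) (h : 𝓢(G, ℂ)) :
    Filter.Tendsto (fun M => ∑ i ∈ Finset.range M, convDist L (φ i) f h) Filter.atTop
      (nhds (f h)) := by
  -- The telescoping formula concerns sums over `range (M + 1)`.
  rw [← Filter.tendsto_add_atTop_iff_nat 1]
  have hL : Filter.Tendsto (fun M : ℕ => ((2 : ℝ) ^ M)⁻¹ • L) Filter.atTop (nhds 0) := by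
    have : Filter.Tendsto (fun M : ℕ => ((2 : ℝ) ^ M)⁻¹) Filter.atTop (nhds 0) :=
      (tendsto_pow_atTop_atTop_of_one_lt one_lt_two).inv_tendsto_atTop
    simpa using this.smul_const L
  have h1 := (f.continuous.tendsto h).comp
    (tendsto_avgCLM (φ 0) hφ.integral_zero_eq_one h hL)
  refine h1.congr fun M => ?_
  simp only [Function.comp_apply, convDist_apply]
  rw [← hφ.avgCLM_sum, ← map_sum]
  congr 1
  ext x
  simp only [avgCLM_apply, _root_.sum_apply, Finset.sum_mul]
  exact integral_finsetSum _ fun i _ => by simpa using integrable_avg L (φ i) h x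

/-- The series converges absolutely in L^∞, which embeds continuously into distributions; its sum
must agree with the weak limit f of the partial sums. -/
theorem IsDyadicResolution.toTemperedDistribution_tsum (hφ : IsDyadicResolution φ)
    (L : Rn n →L[ℝ] G) (f : 𝓢'(G, ℂ)) {F : ℕ → Lp ℂ ∞ (volume : Measure G)}
    (hF : ∀ i, Lp.toTemperedDistribution (F i) = convDist L (φ i) f)
    (hs : Summable fun i => ‖F i‖) : Lp.toTemperedDistribution (∑' i, F i) = f := by
  ext h
  refine tendsto_nhds_unique ?_ (hφ.tendsto_sum_convDist L f h)
  have h1 := (hs.of_norm.hasSum.mapL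
    (Lp.toTemperedDistributionCLM ℂ (volume : Measure G) ∞)).tendsto_sum_nat
  have h2 := ((PointwiseConvergenceCLM.evalCLM (RingHom.id ℂ) ℂ h).continuous.tendsto _).comp h1
  refine h2.congr fun M => ?_
  simp only [Function.comp_apply, map_sum, Lp.toTemperedDistributionCLM_apply, hF]
  rfl

theorem BoundedMeasurable.toLp_sub {H : G → ℂ} (hF : BoundedMeasurable F)
    (hH : BoundedMeasurable H) : (hF.sub hH).toLp = hF.toLp - hH.toLp := rfl

theorem BoundedMeasurable.toLp_sum {ι : Type} (s : Finset ι) {F : ι → G → ℂ}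
    (hF : ∀ i, BoundedMeasurable (F i)) :
    (BoundedMeasurable.sum s hF).toLp = ∑ i ∈ s, (hF i).toLp := by
  apply Lp.ext
  filter_upwards [Lp.coeFn_finsetSum s fun i => (hF i).toLp, (sum s hF).coeFn_toLp,
    s.eventually_all.2 fun i _ => (hF i).coeFn_toLp] with x h1 h2 h3
  rw [h1, h2, Finset.sum_apply, Finset.sum_apply]
  exact Finset.sum_congr rfl fun i hi => (h3 i hi).symm

/-- The tail of the Littlewood-Paley decomposition of a bounded function. -/
theorem IsDyadicResolution.supNorm_sub_sum_le (hφ : IsDyadicResolution φ) (L : Rn n →L[ℝ] G)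
    (hF : BoundedMeasurable F) (J : ℕ) :
    supNorm (F - ∑ i ∈ Finset.range J, conv L (φ i) F) ≤
      ∑' i, supNorm (conv L (φ (i + J)) F) := by
  -- An infinite tail makes the bound trivial; otherwise the blocks are summable and F is their sum
  -- in L^∞.
  by_cases htop : ∑' i, supNorm (conv L (φ (i + J)) F) = ∞
  · rw [htop]; exact le_top
  have hs : Summable fun i => ‖(hF.conv L (φ i)).toLp‖ := by
    rw [← summable_nat_add_iff J]
    refine (ENNReal.summable_toReal htop).congr fun i => ?_
    rw [← BoundedMeasurable.enorm_toLp (hF.conv L (φ (i + J))), toReal_enorm]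
  have h1 : hF.toLp = ∑' i, (hF.conv L (φ i)).toLp :=
    (toTemperedDistribution_injective (hφ.toTemperedDistribution_tsum L hF.toDist
      (fun i => (convDist_toDist L (φ i) hF).symm) hs)).symm
  rw [← hs.of_norm.sum_add_tsum_nat_add J] at h1
  have h2 : (hF.sub (BoundedMeasurable.sum (Finset.range J) fun i => hF.conv L (φ i))).toLp =
      ∑' i, (hF.conv L (φ (i + J))).toLp := by
    rw [BoundedMeasurable.toLp_sub hF (BoundedMeasurable.sum _ fun i => hF.conv L (φ i)),
      BoundedMeasurable.toLp_sum _ fun i => hF.conv L (φ i), h1, add_sub_cancel_left]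
  rw [← BoundedMeasurable.enorm_toLp
    (hF.sub (BoundedMeasurable.sum (Finset.range J) fun i => hF.conv L (φ i))), h2]
  refine enorm_tsum_le_tsum_enorm.trans (le_of_eq ?_)
  exact tsum_congr fun i => BoundedMeasurable.enorm_toLp _

end Distributions

/-! ### Geometric and resonant sums -/

section Sums

theorem two_rpow_add (x y : ℝ) : (2 : ℝ≥0∞) ^ (x + y) = 2 ^ x * 2 ^ y :=
  ENNReal.rpow_add x y two_ne_zero ENNReal.ofNat_ne_top

theorem two_rpow_ne_top (x : ℝ) : (2 : ℝ≥0∞) ^ x ≠ ∞ :=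
  ENNReal.rpow_ne_top_of_ne_zero two_ne_zero ENNReal.ofNat_ne_top

theorem two_rpow_mono {x y : ℝ} (h : x ≤ y) : (2 : ℝ≥0∞) ^ x ≤ 2 ^ y :=
  ENNReal.rpow_le_rpow_of_exponent_le one_le_two h

theorem two_rpow_mul_le_iff {x : ℝ} {N P : ℝ≥0∞} :
    (2 : ℝ≥0∞) ^ x * N ≤ P ↔ N ≤ 2 ^ (-x) * P := by
  have h : (2 : ℝ≥0∞) ^ x * 2 ^ (-x) = 1 := by rw [← two_rpow_add]; simp
  constructor
  · intro hN
    calc N = 2 ^ (-x) * (2 ^ x * N) := by rw [← mul_assoc, mul_comm (2 ^ (-x)), h, one_mul]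
      _ ≤ _ := by gcongr
  · intro hN
    calc 2 ^ x * N ≤ 2 ^ x * (2 ^ (-x) * P) := by gcongr
      _ = P := by rw [← mul_assoc, h, one_mul]

/-- The sum of the geometric series with ratio `2 ^ (-γ)`. -/
noncomputable def geomSum (γ : ℝ) : ℝ≥0∞ := ∑' i : ℕ, (2 : ℝ≥0∞) ^ (-((i : ℝ) * γ))

theorem geomSum_ne_top {γ : ℝ} (hγ : 0 < γ) : geomSum γ ≠ ∞ := by
  have h : ∀ i : ℕ, (2 : ℝ≥0∞) ^ (-((i : ℝ) * γ)) = ((2 : ℝ≥0∞) ^ (-γ)) ^ i := fun i => by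
    rw [← ENNReal.rpow_natCast, ← ENNReal.rpow_mul]
    congr 1
    ring
  simp_rw [geomSum, h, ENNReal.tsum_geometric]
  rw [ENNReal.inv_ne_top]
  exact (tsub_pos_of_lt
    (ENNReal.rpow_lt_one_of_one_lt_of_neg ENNReal.one_lt_two (by linarith))).ne'

theorem tsum_shift_le {γ : ℝ} {N : ℕ → ℝ≥0∞} {P : ℝ≥0∞}
    (h : ∀ k : ℕ, (2 : ℝ≥0∞) ^ ((k : ℝ) * γ) * N k ≤ P) (J : ℕ) :
    ∑' i, N (i + J) ≤ 2 ^ (-((J : ℝ) * γ)) * geomSum γ * P := by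
  rw [geomSum, ← ENNReal.tsum_mul_left, ← ENNReal.tsum_mul_right]
  refine ENNReal.tsum_le_tsum fun i => ?_
  rw [← two_rpow_add]
  convert two_rpow_mul_le_iff.1 (h (i + J)) using 3
  push_cast
  ring

theorem Resonant.symm {a i j : ℕ} (h : Resonant a i j) : Resonant a j i := by
  unfold Resonant at *
  lia

-- If j + 2 < a, resonance leaves at most five values of i, all within 2 of a, and the sum over j is
-- geometric. Otherwise i ≤ j + 4; with α = η + 2δ the exponent iη - jα is then at most 4(η + δ) -
-- iδ - jδ, which is summable in both indices.
open Classical in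
theorem exists_tsum_resonant_le {η α : ℝ} (hη : 0 ≤ η) (hηα : η < α) :
    ∃ C : ℝ≥0∞, C ≠ ∞ ∧ ∀ a : ℕ, ∑' (j : ℕ) (i : ℕ),
      (if Resonant a i j then (2 : ℝ≥0∞) ^ ((i : ℝ) * η - (j : ℝ) * α) else 0) ≤
        C * 2 ^ ((a : ℝ) * η) := by
  set δ := (α - η) / 2 with hδ
  have hδ0 : 0 < δ := by linarith
  refine ⟨5 * 2 ^ (2 * η) * geomSum α + 2 ^ (4 * (η + δ)) * geomSum δ * geomSum δ, ?_, fun a => ?_⟩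
  · have h1 := geomSum_ne_top hδ0
    have h2 := geomSum_ne_top (hη.trans_lt hηα)
    have h3 := two_rpow_ne_top (2 * η)
    have h4 := two_rpow_ne_top (4 * (η + δ))
    finiteness
  have hpt : ∀ j i : ℕ,
      (if Resonant a i j then (2 : ℝ≥0∞) ^ ((i : ℝ) * η - (j : ℝ) * α) else 0) ≤
      (if i ∈ Finset.Icc (a - 2) (a + 2) then
          2 ^ (2 * η) * 2 ^ (-((j : ℝ) * α)) * 2 ^ ((a : ℝ) * η) else 0) +
        2 ^ (4 * (η + δ)) * 2 ^ (-((j : ℝ) * δ)) * 2 ^ (-((i : ℝ) * δ)) := by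
    intro j i
    by_cases hR : Resonant a i j
    · rw [if_pos hR]
      obtain ⟨h1, h2, h3⟩ := hR
      by_cases hj : j + 2 < a
      · rw [if_pos (by rw [Finset.mem_Icc]; lia)]
        refine le_add_right ?_
        rw [← two_rpow_add, ← two_rpow_add]
        apply two_rpow_mono
        have hi : (i : ℝ) ≤ a + 2 := by exact_mod_cast (by lia : i ≤ a + 2)
        nlinarith
      · refine le_add_left ?_
        rw [← two_rpow_add, ← two_rpow_add]
        apply two_rpow_mono
        have hi : (i : ℝ) ≤ j + 4 := by exact_mod_cast (by lia : i ≤ j + 4)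
        have hα : α = η + δ + δ := by rw [hδ]; ring
        rw [hα]
        nlinarith [mul_le_mul_of_nonneg_right hi (add_nonneg hη hδ0.le)]
    · rw [if_neg hR]; exact zero_le
  have h1 : ∀ c : ℝ≥0∞, ∑' i : ℕ, (if i ∈ Finset.Icc (a - 2) (a + 2) then c else 0) ≤ 5 * c :=
    fun c => by
      rw [tsum_eq_sum (s := Finset.Icc (a - 2) (a + 2)) (fun i hi => if_neg hi),
        Finset.sum_congr rfl (fun i hi => if_pos hi), Finset.sum_const, nsmul_eq_mul]
      gcongr
      rw [Nat.card_Icc]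
      exact_mod_cast (by lia : a + 2 + 1 - (a - 2) ≤ 5)
  calc _ ≤ ∑' (j : ℕ) (i : ℕ), ((if i ∈ Finset.Icc (a - 2) (a + 2) then
          2 ^ (2 * η) * 2 ^ (-((j : ℝ) * α)) * 2 ^ ((a : ℝ) * η) else 0) +
        2 ^ (4 * (η + δ)) * 2 ^ (-((j : ℝ) * δ)) * 2 ^ (-((i : ℝ) * δ))) :=
        ENNReal.tsum_le_tsum fun j => ENNReal.tsum_le_tsum fun i => hpt j i
    _ ≤ ∑' j : ℕ, (5 * (2 ^ (2 * η) * 2 ^ (-((j : ℝ) * α)) * 2 ^ ((a : ℝ) * η)) +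
        2 ^ (4 * (η + δ)) * 2 ^ (-((j : ℝ) * δ)) * geomSum δ) := by
        refine ENNReal.tsum_le_tsum fun j => ?_
        rw [ENNReal.tsum_add, ENNReal.tsum_mul_left]
        exact add_le_add (h1 _) le_rfl
    _ = 5 * 2 ^ (2 * η) * geomSum α * 2 ^ ((a : ℝ) * η) +
        2 ^ (4 * (η + δ)) * geomSum δ * geomSum δ := by
        rw [ENNReal.tsum_add, ENNReal.tsum_mul_right, ENNReal.tsum_mul_left, ENNReal.tsum_mul_left,
          ENNReal.tsum_mul_right, ENNReal.tsum_mul_left]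
        simp only [geomSum]
        ring
    _ ≤ _ := by
        rw [add_mul]
        have : (1 : ℝ≥0∞) ≤ 2 ^ ((a : ℝ) * η) := by
          simpa using two_rpow_mono (by positivity : (0 : ℝ) ≤ a * η)
        exact add_le_add le_rfl (le_mul_of_one_le_right zero_le this)

end Sums

/-! ### Products at positive regularity -/

section Products

variable {G : Type} [NormedAddCommGroup G] [NormedSpace ℝ G] [FiniteDimensional ℝ G]
  [MeasureSpace G] [BorelSpace G] [(volume : Measure G).IsAddHaarMeasure]
variable {n : ℕ} {φ : ℕ → 𝓢(Rn n, ℂ)} {U W : G → ℂ}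

theorem IsDyadicResolution.supNorm_sum_conv_le (hφ : IsDyadicResolution φ) (L : Rn n →L[ℝ] G)
    (hU : BoundedMeasurable U) (K : ℕ) :
    supNorm (∑ i ∈ Finset.range K, conv L (φ i) U) ≤
      ENNReal.ofReal (∫ x, ‖φ 0 x‖) * supNorm U := by
  rw [← conv_sum_left L _ _ hU]
  refine (supNorm_conv_le L _ hU).trans ?_
  exact mul_le_mul' (ENNReal.ofReal_le_ofReal (hφ.integral_norm_sum_le K)) le_rfl

theorem IsDyadicResolution.supNorm_conv_le (hφ : IsDyadicResolution φ) (L : Rn n →L[ℝ] G)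
    (hU : BoundedMeasurable U) (i : ℕ) :
    supNorm (conv L (φ i) U) ≤ ENNReal.ofReal (2 * ∫ x, ‖φ 0 x‖) * supNorm U := by
  refine (BiHolder.supNorm_conv_le L _ hU).trans ?_
  exact mul_le_mul' (ENNReal.ofReal_le_ofReal (hφ.integral_norm_le i)) le_rfl

/-- The errors enter one factor at a time, UW - TU·TW = (U - TU)W + TU(W - TW), and the truncation
TU is bounded by U uniformly in K. -/
theorem IsDyadicResolution.supNorm_mul_sub_le (hφ : IsDyadicResolution φ) (L : Rn n →L[ℝ] G)
    (hU : BoundedMeasurable U) (hW : BoundedMeasurable W) (K : ℕ) :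
    supNorm (U * W - (∑ i ∈ Finset.range K, conv L (φ i) U) *
      ∑ j ∈ Finset.range K, conv L (φ j) W) ≤
      (∑' i, supNorm (conv L (φ (i + K)) U)) * supNorm W +
        ENNReal.ofReal (∫ x, ‖φ 0 x‖) * supNorm U * ∑' j, supNorm (conv L (φ (j + K)) W) := by
  set TU := ∑ i ∈ Finset.range K, conv L (φ i) U
  set TW := ∑ j ∈ Finset.range K, conv L (φ j) W
  have h : U * W - TU * TW = (U - TU) * W + TU * (W - TW) := by ring
  rw [h]
  refine (supNorm_add_le _ _).trans (add_le_add ?_ ?_) <;> refine (supNorm_mul_le _ _).trans ?_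
  · gcongr
    exact hφ.supNorm_sub_sum_le L hU K
  · gcongr
    · exact hφ.supNorm_sum_conv_le L hU K
    · exact hφ.supNorm_sub_sum_le L hW K

theorem sum_conv_mul_sum_conv {ι : Type} (s : Finset ι) (L : Rn n →L[ℝ] G) (ρ : ι → 𝓢(Rn n, ℂ))
    (U W : G → ℂ) : (∑ i ∈ s, conv L (ρ i) U) * ∑ j ∈ s, conv L (ρ j) W =
      ∑ j ∈ s, ∑ i ∈ s, conv L (ρ i) U * conv L (ρ j) W := by
  rw [Finset.mul_sum]
  simp only [Finset.sum_mul]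

theorem IsDyadicResolution.supNorm_le (hφ : IsDyadicResolution φ) (L : Rn n →L[ℝ] G) {γ : ℝ}
    (hU : BoundedMeasurable U) {P : ℝ≥0∞}
    (hP : ∀ k : ℕ, (2 : ℝ≥0∞) ^ ((k : ℝ) * γ) * supNorm (conv L (φ k) U) ≤ P) :
    supNorm U ≤ geomSum γ * P := by
  have h := (hφ.supNorm_sub_sum_le L hU 0).trans (tsum_shift_le hP 0)
  simpa using h

/-- Products of functions of positive regularity in some of the variables. -/
theorem IsDyadicResolution.exists_product_le (hφ : IsDyadicResolution φ) (L : Rn n →L[ℝ] G) {γ : ℝ}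
    (hγ : 0 < γ) :
    ∃ C : ℝ≥0∞, C ≠ ∞ ∧ ∀ (U W : G → ℂ), BoundedMeasurable U → BoundedMeasurable W →
      ∀ P Q : ℝ≥0∞, (∀ k : ℕ, (2 : ℝ≥0∞) ^ ((k : ℝ) * γ) * supNorm (conv L (φ k) U) ≤ P) →
      (∀ k : ℕ, (2 : ℝ≥0∞) ^ ((k : ℝ) * γ) * supNorm (conv L (φ k) W) ≤ Q) →
      ∀ b : ℕ, (2 : ℝ≥0∞) ^ ((b : ℝ) * γ) * supNorm (conv L (φ b) (U * W)) ≤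
        C * (P * supNorm W + supNorm U * Q) := by
  set c₁ := ENNReal.ofReal (∫ x, ‖φ 0 x‖)
  set c₂ := ENNReal.ofReal (2 * ∫ x, ‖φ 0 x‖)
  refine ⟨c₂ * (2 ^ (2 * γ) * geomSum γ * (1 + c₁)), ?_, ?_⟩
  · have h1 := geomSum_ne_top hγ
    have h2 := two_rpow_ne_top (2 * γ)
    finiteness
  intro U W hU hW P Q hP hQ b
  -- Indices below b - 2 are too small to resonate with b, so block b sees only the tails of U and
  -- W. For b ≤ 2 the sums are empty.
  set TU := ∑ i ∈ Finset.range (b - 2), conv L (φ i) U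
  set TW := ∑ j ∈ Finset.range (b - 2), conv L (φ j) W
  have hTU : BoundedMeasurable TU := BoundedMeasurable.sum _ fun i => hU.conv L (φ i)
  have hTW : BoundedMeasurable TW := BoundedMeasurable.sum _ fun i => hW.conv L (φ i)
  have hzero : conv L (φ b) (TU * TW) = 0 := by
    rw [sum_conv_mul_sum_conv, conv_sum L _ _ fun j => BoundedMeasurable.sum _ fun i =>
      (hU.conv L (φ i)).mul (hW.conv L (φ j))]
    refine Finset.sum_eq_zero fun j hj => ?_
    rw [conv_sum L _ _ fun i => (hU.conv L (φ i)).mul (hW.conv L (φ j))]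
    refine Finset.sum_eq_zero fun i hi => hφ.conv_mul_conv_eq_zero L ?_ hU hW
    rw [Finset.mem_range] at hi hj
    unfold Resonant
    lia
  have h1 : conv L (φ b) (U * W) = conv L (φ b) (U * W - TU * TW) := by
    rw [conv_sub L _ (hU.mul hW) (hTU.mul hTW), hzero, sub_zero]
  -- Starting the tails at b - 2 costs the factor 2^{2γ}; b ≤ (b - 2) + 2 also holds under truncated
  -- subtraction.
  have hK : (2 : ℝ≥0∞) ^ (-(((b - 2 : ℕ) : ℝ) * γ)) ≤ 2 ^ (-((b : ℝ) * γ)) * 2 ^ (2 * γ) := by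
    rw [← two_rpow_add]
    apply two_rpow_mono
    have : (b : ℝ) ≤ ((b - 2 : ℕ) : ℝ) + 2 := by exact_mod_cast (by lia : b ≤ b - 2 + 2)
    nlinarith
  rw [two_rpow_mul_le_iff, h1]
  refine (hφ.supNorm_conv_le L ((hU.mul hW).sub (hTU.mul hTW)) b).trans ?_
  calc c₂ * supNorm (U * W - TU * TW)
      ≤ c₂ * ((∑' i, supNorm (conv L (φ (i + (b - 2))) U)) * supNorm W +
        c₁ * supNorm U * ∑' j, supNorm (conv L (φ (j + (b - 2))) W)) := by
        gcongr
        exact hφ.supNorm_mul_sub_le L hU hW (b - 2)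
    _ ≤ c₂ * (((2 ^ (-((b : ℝ) * γ)) * 2 ^ (2 * γ)) * geomSum γ * P) * supNorm W +
        c₁ * supNorm U * ((2 ^ (-((b : ℝ) * γ)) * 2 ^ (2 * γ)) * geomSum γ * Q)) := by
        gcongr
        · exact (tsum_shift_le hP _).trans (by gcongr)
        · exact (tsum_shift_le hQ _).trans (by gcongr)
    _ = 2 ^ (-((b : ℝ) * γ)) * (c₂ * (2 ^ (2 * γ) * geomSum γ *
        (1 * (P * supNorm W) + c₁ * (supNorm U * Q)))) := by ring
    _ ≤ 2 ^ (-((b : ℝ) * γ)) * (c₂ * (2 ^ (2 * γ) * geomSum γ *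
        ((1 + c₁) * (P * supNorm W) + (1 + c₁) * (supNorm U * Q)))) := by
        gcongr
        · exact le_self_add
        · exact le_add_self
    _ = _ := by ring

end Products

/-! ### The mixed estimate in x and s -/

section Mixed

variable {G : Type} [NormedAddCommGroup G] [NormedSpace ℝ G] [FiniteDimensional ℝ G]
  [MeasureSpace G] [BorelSpace G] [(volume : Measure G).IsAddHaarMeasure]
variable {n q : ℕ} {φ : ℕ → 𝓢(Rn n, ℂ)} {ψ : ℕ → 𝓢(Rn q, ℂ)} {U W : G → ℂ}

/-- Truncating both decompositions at J leaves a finite double sum, controlled by the full series,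
and a remainder controlled by the tails of two convergent series. The remainder disappears as J → ∞.
-/
theorem IsDyadicResolution.supNorm_conv_conv_mul_le (hφ : IsDyadicResolution φ)
    (hψ : IsDyadicResolution ψ) (L : Rn n →L[ℝ] G) (L' : Rn q →L[ℝ] G)
    (hU : BoundedMeasurable U) (hW : BoundedMeasurable W)
    (hUs : ∑' i, supNorm (conv L (φ i) U) ≠ ∞) (hWs : ∑' j, supNorm (conv L (φ j) W) ≠ ∞)
    (a b : ℕ) :
    supNorm (conv L (φ a) (conv L' (ψ b) (U * W))) ≤
      ∑' (j : ℕ) (i : ℕ), supNorm (conv L (φ a) (conv L' (ψ b)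
        (conv L (φ i) U * conv L (φ j) W))) := by
  set c₁ := ENNReal.ofReal (∫ x, ‖φ 0 x‖)
  set c₂ := ENNReal.ofReal (2 * ∫ x, ‖φ 0 x‖)
  set c₃ := ENNReal.ofReal (2 * ∫ x, ‖ψ 0 x‖)
  set S := ∑' (j : ℕ) (i : ℕ), supNorm (conv L (φ a) (conv L' (ψ b)
    (conv L (φ i) U * conv L (φ j) W)))
  have hlim : Filter.Tendsto (fun J : ℕ => c₂ * (c₃ *
      ((∑' i, supNorm (conv L (φ (i + J)) U)) * supNorm W +
        c₁ * supNorm U * ∑' j, supNorm (conv L (φ (j + J)) W))) + S) Filter.atTop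
      (nhds (c₂ * (c₃ * (0 * supNorm W + c₁ * supNorm U * 0)) + S)) := by
    have h1 := ENNReal.tendsto_sum_nat_add _ hUs
    have h2 := ENNReal.tendsto_sum_nat_add _ hWs
    have hU0 := hU.supNorm_ne_top
    have h3 := ENNReal.Tendsto.mul_const h1 (Or.inr hW.supNorm_ne_top)
    have h4 := ENNReal.Tendsto.const_mul h2 (a := c₁ * supNorm U) (Or.inr (by finiteness))
    refine Filter.Tendsto.add ?_ tendsto_const_nhds
    exact ENNReal.Tendsto.const_mul (ENNReal.Tendsto.const_mul (h3.add h4)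
      (Or.inr ENNReal.ofReal_ne_top)) (Or.inr ENNReal.ofReal_ne_top)
  have hlim' := ge_of_tendsto' (b := supNorm (conv L (φ a) (conv L' (ψ b) (U * W)))) hlim
    fun J => ?_
  · simpa using hlim'
  have hm : ∀ i j, BoundedMeasurable (conv L (φ i) U * conv L (φ j) W) := fun i j =>
    (hU.conv L (φ i)).mul (hW.conv L (φ j))
  set T := (∑ i ∈ Finset.range J, conv L (φ i) U) * ∑ j ∈ Finset.range J, conv L (φ j) W
  have hT : BoundedMeasurable T := (BoundedMeasurable.sum _ fun i => hU.conv L (φ i)).mul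
    (BoundedMeasurable.sum _ fun j => hW.conv L (φ j))
  have hD : BoundedMeasurable (U * W - T) := (hU.mul hW).sub hT
  have hsplit : conv L (φ a) (conv L' (ψ b) (U * W)) =
      conv L (φ a) (conv L' (ψ b) (U * W - T)) + conv L (φ a) (conv L' (ψ b) T) := by
    rw [← conv_add _ _ (hD.conv L' _) (hT.conv L' _), ← conv_add _ _ hD hT, sub_add_cancel]
  have hsum : conv L (φ a) (conv L' (ψ b) T) = ∑ j ∈ Finset.range J, ∑ i ∈ Finset.range J,
      conv L (φ a) (conv L' (ψ b) (conv L (φ i) U * conv L (φ j) W)) := by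
    rw [show T = _ from sum_conv_mul_sum_conv _ L φ U W,
      conv_sum L' _ _ fun j => BoundedMeasurable.sum _ fun i => hm i j,
      conv_sum L _ _ fun j => (BoundedMeasurable.sum _ fun i => hm i j).conv L' _]
    refine Finset.sum_congr rfl fun j _ => ?_
    rw [conv_sum L' _ _ fun i => hm i j, conv_sum L _ _ fun i => (hm i j).conv L' _]
  rw [hsplit]
  refine (supNorm_add_le _ _).trans (add_le_add ?_ ?_)
  · refine (hφ.supNorm_conv_le L (hD.conv L' _) a).trans ?_
    gcongr
    refine (hψ.supNorm_conv_le L' hD b).trans ?_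
    gcongr
    exact hφ.supNorm_mul_sub_le L hU hW J
  · rw [hsum]
    refine (supNorm_sum_le _ _).trans (le_trans ?_ (ENNReal.sum_le_tsum (Finset.range J)))
    refine Finset.sum_le_sum fun j _ => ?_
    exact (supNorm_sum_le _ _).trans (ENNReal.sum_le_tsum (Finset.range J))

/-- The product estimate for the mixed norm. -/
theorem IsDyadicResolution.exists_mixed_product_le (hφ : IsDyadicResolution φ)
    (hψ : IsDyadicResolution ψ) (L : Rn n →L[ℝ] G) (L' : Rn q →L[ℝ] G) {α β η θ : ℝ}
    (hβ : 0 < β) (hη : 0 ≤ η) (hθ : 0 ≤ θ) (hηθ : η + θ < α) :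
    ∃ C : ℝ≥0∞, C ≠ ∞ ∧ ∀ (U W : G → ℂ), BoundedMeasurable U → BoundedMeasurable W →
      ∀ A B A' B' : ℝ≥0∞, A ≠ ∞ → A' ≠ ∞ →
      (∀ i : ℕ, (2 : ℝ≥0∞) ^ ((i : ℝ) * α) * supNorm (conv L (φ i) U) ≤ A) →
      (∀ i k : ℕ, (2 : ℝ≥0∞) ^ ((i : ℝ) * (-η) + (k : ℝ) * β) *
        supNorm (conv L (φ i) (conv L' (ψ k) U)) ≤ B) →
      (∀ j : ℕ, (2 : ℝ≥0∞) ^ ((j : ℝ) * (α - θ)) * supNorm (conv L (φ j) W) ≤ A') →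
      (∀ j k : ℕ, (2 : ℝ≥0∞) ^ ((j : ℝ) * (-η - θ) + (k : ℝ) * β) *
        supNorm (conv L (φ j) (conv L' (ψ k) W)) ≤ B') →
      ∀ a b : ℕ, (2 : ℝ≥0∞) ^ ((a : ℝ) * (-η - θ) + (b : ℝ) * β) *
        supNorm (conv L (φ a) (conv L' (ψ b) (U * W))) ≤ C * (B * A' + A * B') := by
  classical
  obtain ⟨C₁, hC₁, hprod⟩ := hψ.exists_product_le L' hβ
  -- The first sum has the s-regularity on f and the decay in x on g; the second has these roles
  -- exchanged. Each needs its growth exponent below its decay exponent, which in both cases is η +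
  -- θ < α.
  obtain ⟨C₂, hC₂, hsum₂⟩ := exists_tsum_resonant_le (η := η) (α := α - θ) hη (by linarith)
  obtain ⟨C₃, hC₃, hsum₃⟩ := exists_tsum_resonant_le (η := η + θ) (α := α) (by linarith) hηθ
  set c₂ := ENNReal.ofReal (2 * ∫ x, ‖φ 0 x‖)
  refine ⟨c₂ * (C₁ * (C₂ + C₃)), by finiteness, ?_⟩
  intro U W hU hW A B A' B' hAtop hAtop' hA hB hA' hB' a b
  have hts : ∀ {N : ℕ → ℝ≥0∞} {γ : ℝ} {P : ℝ≥0∞}, 0 < γ → P ≠ ∞ →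
      (∀ k : ℕ, (2 : ℝ≥0∞) ^ ((k : ℝ) * γ) * N k ≤ P) → ∑' i, N i ≠ ∞ := by
    intro N γ P hγ hP h
    have h1 := tsum_shift_le h 0
    have h2 := geomSum_ne_top hγ
    refine ne_top_of_le_ne_top ?_ (by simpa using h1)
    finiteness
  have hpt : ∀ i j : ℕ, supNorm (conv L (φ a) (conv L' (ψ b) (conv L (φ i) U * conv L (φ j) W))) ≤
      c₂ * (2 ^ (-((b : ℝ) * β)) * (C₁ *
        (B * A' * (if Resonant a i j then 2 ^ ((i : ℝ) * η - (j : ℝ) * (α - θ)) else 0) +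
        A * B' * (if Resonant a j i then 2 ^ ((j : ℝ) * (η + θ) - (i : ℝ) * α) else 0)))) := by
    intro i j
    have hi := hU.conv L (φ i)
    have hj := hW.conv L (φ j)
    by_cases hR : Resonant a i j
    · rw [if_pos hR, if_pos hR.symm]
      refine (hφ.supNorm_conv_le L ((hi.mul hj).conv L' _) a).trans ?_
      gcongr
      -- For fixed i and j the s-regularity constants of the blocks are the mixed norms with their
      -- x-weights moved to the right-hand side.
      have h1 := hprod _ _ hi hj (2 ^ ((i : ℝ) * η) * B) (2 ^ ((j : ℝ) * (η + θ)) * B')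
        (fun k => by
          have := hB i k
          rw [two_rpow_add, mul_assoc, two_rpow_mul_le_iff] at this
          rw [conv_comm L' _ L _ hU]
          convert this using 3
          ring)
        (fun k => by
          have := hB' j k
          rw [two_rpow_add, mul_assoc, two_rpow_mul_le_iff] at this
          rw [conv_comm L' _ L _ hW]
          convert this using 3
          ring) b
      rw [two_rpow_mul_le_iff] at h1
      refine h1.trans ?_
      have h2 := two_rpow_mul_le_iff.1 (hA i)
      have h3 := two_rpow_mul_le_iff.1 (hA' j)
      refine mul_le_mul' le_rfl (mul_le_mul' le_rfl ?_)
      calc _ ≤ 2 ^ ((i : ℝ) * η) * B * (2 ^ (-((j : ℝ) * (α - θ))) * A') +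
            2 ^ (-((i : ℝ) * α)) * A * (2 ^ ((j : ℝ) * (η + θ)) * B') := by gcongr
        _ = _ := by
          rw [sub_eq_add_neg ((i : ℝ) * η), sub_eq_add_neg ((j : ℝ) * (η + θ)), two_rpow_add,
            two_rpow_add]
          ring
    -- Convolutions in x and s commute, so frequency localisation in x acts directly on the product
    -- of blocks.
    · have h0 : conv L (φ a) (conv L' (ψ b) (conv L (φ i) U * conv L (φ j) W)) = 0 := by
        rw [conv_comm L _ L' _ (hi.mul hj), hφ.conv_mul_conv_eq_zero L hR hU hW, conv_zero]
      rw [h0, supNorm_zero]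
      exact zero_le
  have htot : supNorm (conv L (φ a) (conv L' (ψ b) (U * W))) ≤
      c₂ * (2 ^ (-((b : ℝ) * β)) * (C₁ * (B * A' * (C₂ * 2 ^ ((a : ℝ) * η)) +
        A * B' * (C₃ * 2 ^ ((a : ℝ) * (η + θ)))))) := by
    refine (hφ.supNorm_conv_conv_mul_le hψ L L' hU hW (hts (by linarith) hAtop hA)
      (hts (by linarith) hAtop' hA') a b).trans ?_
    refine (ENNReal.tsum_le_tsum fun j => ENNReal.tsum_le_tsum fun i => hpt i j).trans ?_
    simp only [ENNReal.tsum_mul_left, ENNReal.tsum_add]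
    gcongr
    · exact hsum₂ a
    -- In the second term i carries the decay and j the growth.
    · rw [ENNReal.tsum_comm]
      exact hsum₃ a
  have hexp : -((a : ℝ) * (-η - θ) + (b : ℝ) * β) = -((b : ℝ) * β) + (a : ℝ) * (η + θ) := by ring
  rw [two_rpow_mul_le_iff, hexp, two_rpow_add]
  have hmono : (2 : ℝ≥0∞) ^ ((a : ℝ) * η) ≤ 2 ^ ((a : ℝ) * (η + θ)) :=
    two_rpow_mono (by gcongr; linarith)
  calc _ ≤ _ := htot
    _ ≤ c₂ * (2 ^ (-((b : ℝ) * β)) * (C₁ * (B * A' * ((C₂ + C₃) * 2 ^ ((a : ℝ) * (η + θ))) +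
        A * B' * ((C₂ + C₃) * 2 ^ ((a : ℝ) * (η + θ)))))) := by
        gcongr
        · exact le_self_add
        · exact le_add_self
    _ = _ := by ring

end Mixed

/-! ### Norms of distributions given by bounded functions -/

section Norms

variable {n q : ℕ} {φ : ℕ → 𝓢(Rn n, ℂ)} {ψ : ℕ → 𝓢(Rn q, ℂ)} {F H : Rn n × Rn q → ℂ}

/-- Injectivity of the embedding of L^∞ leaves a single candidate in the infimum. -/
theorem linftyNorm_toTemperedDistribution (F : Lp ℂ ∞ (volume : Measure (Rn n × Rn q))) :
    linftyNorm (Lp.toTemperedDistribution F) = ‖F‖ₑ := by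
  refine le_antisymm (iInf₂_le (f := fun F' (_ : Lp.toTemperedDistribution F' =
    Lp.toTemperedDistribution F) => ‖F'‖ₑ) F rfl) (le_iInf₂ fun F' hF' => ?_)
  rw [toTemperedDistribution_injective hF']

theorem BoundedMeasurable.linftyNorm_toDist (hF : BoundedMeasurable F) :
    linftyNorm hF.toDist = supNorm F :=
  (linftyNorm_toTemperedDistribution _).trans hF.enorm_toLp

theorem exists_toTemperedDistribution_eq {f : Dist n q} (hf : linftyNorm f ≠ ∞) :
    ∃ F : Lp ℂ ∞ (volume : Measure (Rn n × Rn q)), Lp.toTemperedDistribution F = f := by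
  by_contra! h
  exact hf (by simp [linftyNorm, h])

theorem BoundedMeasurable.normCL_toDist (hF : BoundedMeasurable F) (a : ℝ) :
    normCL φ a hF.toDist = ⨆ j : ℕ, (2 : ℝ≥0∞) ^ ((j : ℝ) * a) *
      supNorm (BiHolder.conv (ContinuousLinearMap.inl ℝ (Rn n) (Rn q)) (φ j) F) := by
  refine iSup_congr fun j => ?_
  rw [← (hF.conv _ (φ j)).linftyNorm_toDist, ← convDist_toDist]
  rfl

theorem BoundedMeasurable.normCC_toDist (hF : BoundedMeasurable F) (a b : ℝ) :
    normCC φ ψ a b hF.toDist = ⨆ (j : ℕ) (k : ℕ), (2 : ℝ≥0∞) ^ ((j : ℝ) * a + (k : ℝ) * b) *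
      supNorm (BiHolder.conv (ContinuousLinearMap.inl ℝ (Rn n) (Rn q)) (φ j)
        (BiHolder.conv (ContinuousLinearMap.inr ℝ (Rn n) (Rn q)) (ψ k) F)) := by
  refine iSup_congr fun j => iSup_congr fun k => ?_
  rw [← ((hF.conv _ (ψ k)).conv _ (φ j)).linftyNorm_toDist, ← convDist_toDist _ _ (hF.conv _ (ψ k)),
    ← convDist_toDist]
  rfl

theorem BoundedMeasurable.le_normCL (hF : BoundedMeasurable F) (a : ℝ) (j : ℕ) :
    (2 : ℝ≥0∞) ^ ((j : ℝ) * a) *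
      supNorm (BiHolder.conv (ContinuousLinearMap.inl ℝ (Rn n) (Rn q)) (φ j) F) ≤
      normCL φ a hF.toDist := by
  rw [hF.normCL_toDist]
  exact le_iSup (fun j : ℕ => (2 : ℝ≥0∞) ^ ((j : ℝ) * a) *
    supNorm (BiHolder.conv (ContinuousLinearMap.inl ℝ (Rn n) (Rn q)) (φ j) F)) j

theorem BoundedMeasurable.le_normCC (hF : BoundedMeasurable F) (a b : ℝ) (j k : ℕ) :
    (2 : ℝ≥0∞) ^ ((j : ℝ) * a + (k : ℝ) * b) *
      supNorm (BiHolder.conv (ContinuousLinearMap.inl ℝ (Rn n) (Rn q)) (φ j)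
        (BiHolder.conv (ContinuousLinearMap.inr ℝ (Rn n) (Rn q)) (ψ k) F)) ≤
      normCC φ ψ a b hF.toDist := by
  rw [hF.normCC_toDist]
  exact le_iSup₂ (f := fun j k : ℕ => (2 : ℝ≥0∞) ^ ((j : ℝ) * a + (k : ℝ) * b) *
    supNorm (BiHolder.conv (ContinuousLinearMap.inl ℝ (Rn n) (Rn q)) (φ j)
      (BiHolder.conv (ContinuousLinearMap.inr ℝ (Rn n) (Rn q)) (ψ k) F))) j k

theorem toTemperedDistribution_eq_toDist (hF : BoundedMeasurable F)
    {F' : Lp ℂ ∞ (volume : Measure (Rn n × Rn q))} (h : ∀ᵐ x, F' x = F x) :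
    Lp.toTemperedDistribution F' = hF.toDist := by
  have : F' = hF.toLp := by
    apply Lp.ext
    filter_upwards [h, hF.coeFn_toLp] with x h1 h2
    rw [h1, h2]
  rw [this]
  rfl

/-- Distributions of positive regularity in `x` are given by bounded functions. -/
theorem IsDyadicResolution.exists_toDist_eq (hφ : IsDyadicResolution φ) {a : ℝ} (ha : 0 < a)
    {f : Dist n q} (hf : normCL φ a f ≠ ∞) :
    ∃ (F : Rn n × Rn q → ℂ) (hF : BoundedMeasurable F), hF.toDist = f := by
  have hle : ∀ j : ℕ, (2 : ℝ≥0∞) ^ ((j : ℝ) * a) * linftyNorm (convX (φ j) f) ≤ normCL φ a f :=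
    fun j => le_iSup (fun j : ℕ => (2 : ℝ≥0∞) ^ ((j : ℝ) * a) * linftyNorm (convX (φ j) f)) j
  have hfin : ∀ j, linftyNorm (convX (φ j) f) ≠ ∞ := fun j => by
    refine ne_top_of_le_ne_top ?_ (two_rpow_mul_le_iff.1 (hle j))
    have := two_rpow_ne_top (-((j : ℝ) * a))
    finiteness
  choose F hF using fun j => exists_toTemperedDistribution_eq (hfin j)
  have hsum : ∑' j, ‖F j‖ₑ ≠ ∞ := by
    have h1 := tsum_shift_le hle 0
    have h2 := geomSum_ne_top ha
    simp_rw [← hF, linftyNorm_toTemperedDistribution] at h1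
    refine ne_top_of_le_ne_top ?_ (by simpa using h1)
    finiteness
  have hs : Summable fun j => ‖F j‖ :=
    (ENNReal.summable_toReal hsum).congr fun j => by rw [toReal_enorm]
  obtain ⟨F', hF', hae⟩ := BoundedMeasurable.exists_rep (∑' j, F j)
  refine ⟨F', hF', ?_⟩
  rw [← toTemperedDistribution_eq_toDist hF' hae]
  exact hφ.toTemperedDistribution_tsum (ContinuousLinearMap.inl ℝ (Rn n) (Rn q)) f hF hs

/-- The representatives are unique almost everywhere, so the relation determines p; existence and
uniqueness of the product both follow from this equivalence. -/
theorem isPointwiseProduct_toDist_iff (hF : BoundedMeasurable F) (hH : BoundedMeasurable H)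
    (p : Dist n q) : IsPointwiseProduct hF.toDist hH.toDist p ↔ p = (hF.mul hH).toDist := by
  constructor
  · rintro ⟨F', H', P, h1, h2, rfl, h⟩
    refine toTemperedDistribution_eq_toDist _ ?_
    rw [toTemperedDistribution_injective h1, toTemperedDistribution_injective h2] at h
    filter_upwards [h, hF.coeFn_toLp, hH.coeFn_toLp] with x h3 h4 h5
    rw [h3, h4, h5, Pi.mul_apply]
  · rintro rfl
    refine ⟨hF.toLp, hH.toLp, (hF.mul hH).toLp, rfl, rfl, rfl, ?_⟩
    filter_upwards [(hF.mul hH).coeFn_toLp, hF.coeFn_toLp, hH.coeFn_toLp] with x h3 h4 h5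
    rw [h3, h4, h5, Pi.mul_apply]

/-- The product estimate in `𝒞^a_x L^∞_s ∩ 𝒞^c_x 𝒞^b_s` for bounded functions. -/
theorem exists_normInter_mul_le (hφ : IsDyadicResolution φ) (hψ : IsDyadicResolution ψ)
    {α β η θ : ℝ} (hβ : 0 < β) (hη : 0 ≤ η) (hθ : 0 ≤ θ) (hηθ : η + θ < α) :
    ∃ C : ℝ≥0∞, C ≠ ∞ ∧ ∀ (F H : Rn n × Rn q → ℂ) (hF : BoundedMeasurable F)
      (hH : BoundedMeasurable H), normInter φ ψ α (-η) β hF.toDist ≠ ∞ →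
      normInter φ ψ (α - θ) (-η - θ) β hH.toDist ≠ ∞ →
      normInter φ ψ (α - θ) (-η - θ) β (hF.mul hH).toDist ≤
        C * normInter φ ψ α (-η) β hF.toDist * normInter φ ψ (α - θ) (-η - θ) β hH.toDist := by
  set L := ContinuousLinearMap.inl ℝ (Rn n) (Rn q)
  set L' := ContinuousLinearMap.inr ℝ (Rn n) (Rn q)
  have hα' : 0 < α - θ := by linarith
  have hα : 0 < α := by linarith
  obtain ⟨C₁, hC₁, h₁⟩ := hφ.exists_product_le L hα'
  obtain ⟨C₂, hC₂, h₂⟩ := hφ.exists_mixed_product_le hψ L L' hβ hη hθ hηθ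
  have hg := geomSum_ne_top hα
  have hg' := geomSum_ne_top hα'
  refine ⟨C₁ * (geomSum (α - θ) + geomSum α) + C₂, by finiteness, ?_⟩
  intro F H hF hH hFt hHt
  set A := normCL φ α hF.toDist with hAdef
  set B := normCC φ ψ (-η) β hF.toDist with hBdef
  set A' := normCL φ (α - θ) hH.toDist with hAdef'
  set B' := normCC φ ψ (-η - θ) β hH.toDist with hBdef'
  have hA : ∀ i : ℕ, (2 : ℝ≥0∞) ^ ((i : ℝ) * α) * supNorm (conv L (φ i) F) ≤ A :=
    fun i => hF.le_normCL α i
  have hA' : ∀ i : ℕ, (2 : ℝ≥0∞) ^ ((i : ℝ) * (α - θ)) * supNorm (conv L (φ i) H) ≤ A' :=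
    fun i => hH.le_normCL _ i
  -- Since θ ≥ 0, f also has regularity α - θ, the common exponent at which f and g are multiplied.
  have hAw : ∀ i : ℕ, (2 : ℝ≥0∞) ^ ((i : ℝ) * (α - θ)) * supNorm (conv L (φ i) F) ≤ A := fun i =>
    (mul_le_mul' (two_rpow_mono (by gcongr; linarith)) le_rfl).trans (hA i)
  have hAt : A ≠ ∞ := ne_top_of_le_ne_top hFt le_self_add
  have hAt' : A' ≠ ∞ := ne_top_of_le_ne_top hHt le_self_add
  have hCL : normCL φ (α - θ) (hF.mul hH).toDist ≤
      C₁ * (geomSum (α - θ) + geomSum α) * (A * A') := by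
    rw [(hF.mul hH).normCL_toDist]
    refine iSup_le fun b => (h₁ F H hF hH A A' hAw hA' b).trans ?_
    calc _ ≤ C₁ * (A * (geomSum (α - θ) * A') + (geomSum α * A) * A') := by
          gcongr
          · exact hφ.supNorm_le L hH hA'
          · exact hφ.supNorm_le L hF hA
      _ = _ := by ring
  have hCC : normCC φ ψ (-η - θ) β (hF.mul hH).toDist ≤ C₂ * (B * A' + A * B') := by
    rw [(hF.mul hH).normCC_toDist]
    exact iSup₂_le fun a b => h₂ F H hF hH A B A' B' hAt hAt' hA (hF.le_normCC _ _) hA'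
      (hH.le_normCC _ _) a b
  set D := C₁ * (geomSum (α - θ) + geomSum α)
  calc _ ≤ D * (A * A') + C₂ * (B * A' + A * B') := add_le_add hCL hCC
    -- All the products on the left occur in the expansion of (A + B)(A' + B'); the term B B' is
    -- only added to close the form.
    _ ≤ D * ((A + B) * (A' + B')) + C₂ * ((A + B) * (A' + B')) := by
        have h1 : A * A' ≤ (A + B) * (A' + B') := mul_le_mul' le_self_add le_self_add
        have h2 : B * A' + A * B' ≤ (A + B) * (A' + B') := by
          calc _ ≤ (B * A' + A * B') + (A * A' + B * B') := le_self_add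
            _ = _ := by ring
        gcongr
    _ = _ := by
        simp only [normInter, ← hAdef, ← hBdef, ← hAdef', ← hBdef']
        ring

end Norms

end BiHolder

/-! ### The product theorem -/

theorem mainTheorem6 (n q : ℕ)
    (φ : ℕ → 𝓢(EuclideanSpace ℝ (Fin n), ℂ)) (ψ : ℕ → 𝓢(EuclideanSpace ℝ (Fin q), ℂ))
    (hφ : BiHolder.IsDyadicResolution φ) (hψ : BiHolder.IsDyadicResolution ψ)
    (α β η θ : ℝ) (hα : 0 < α) (hβ : 0 < β)
    (hη : η ∈ Set.Icc (0 : ℝ) 1) (hθ : θ ∈ Set.Icc (0 : ℝ) 1) (hηθ : η + θ < α) :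
    ∃ C : ℝ, 0 < C ∧
      ∀ f ∈ BiHolder.spaceInter φ ψ α (-η) β,
      ∀ g ∈ BiHolder.spaceInter φ ψ (α - θ) (-η - θ) β,
        (∃! p, BiHolder.IsPointwiseProduct f g p) ∧
        ∀ p, BiHolder.IsPointwiseProduct f g p →
          p ∈ BiHolder.spaceInter φ ψ (α - θ) (-η - θ) β ∧
          BiHolder.normInter φ ψ (α - θ) (-η - θ) β p ≤
            ENNReal.ofReal C * BiHolder.normInter φ ψ α (-η) β f *
              BiHolder.normInter φ ψ (α - θ) (-η - θ) β g := by
  obtain ⟨C, hC, hmul⟩ := BiHolder.exists_normInter_mul_le hφ hψ hβ hη.1 hθ.1 hηθ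
  -- C is finite but might be 0; adding 1 makes the real constant positive.
  refine ⟨C.toReal + 1, by positivity, fun f hf g hg => ?_⟩
  have hf' : BiHolder.normInter φ ψ α (-η) β f ≠ ∞ := ne_of_lt hf
  have hg' : BiHolder.normInter φ ψ (α - θ) (-η - θ) β g ≠ ∞ := ne_of_lt hg
  obtain ⟨F, hF, rfl⟩ := hφ.exists_toDist_eq hα (ne_top_of_le_ne_top hf' le_self_add)
  obtain ⟨H, hH, rfl⟩ := hφ.exists_toDist_eq (by linarith [hη.1] : 0 < α - θ)
    (ne_top_of_le_ne_top hg' le_self_add)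
  simp only [BiHolder.isPointwiseProduct_toDist_iff, existsUnique_eq, true_and]
  rintro p rfl
  have hle := hmul F H hF hH hf' hg'
  refine ⟨lt_of_le_of_lt hle (by finiteness), hle.trans ?_⟩
  gcongr
  rw [ENNReal.le_ofReal_iff_toReal_le hC (by positivity)]
  linarith
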